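/- Let $d \ge 1$ and let $A \subset \mathbb{R}^d$ have piecewise smooth boundary: $\partial A$ is a finite union of compact pieces, each the image of a compact subset of $\mathbb{R}^{d-1}$ under a map into $\mathbb{R}^d$ that is $C^1$ in a neighbourhood of that compact set. A point $(x,t) \in \mathbb{R}^d \times \mathbb{R}^+$ represents an open ball of unit radius with centre $x$ that arrives at time $t$. Given an input $\mathcal{X} \subset \mathbb{R}^d \times \mathbb{R}^+$, a ball of $\mathcal{X}$ is packed if and only if it does not overlap any ball of $\mathcal{X}$ that arrived earlier and has been packed; otherwise it is discarded. Let $\pi(\mathcal{X}) \subset \mathbb{R}^d$ be the set of centres of the packed balls, and let $\mathcal{X}_A := \mathcal{X} \cap (A \times \mathbb{R}^+)$. Let the input $\mathcal{P}$ be either (i) (continuum) a rate one homogeneous Poisson point process on $\mathbb{R}^d \times [0,\tau]$, for some $0 < \tau < \infty$; or (ii) (lattice) a family of independent rate one homogeneous Poisson point processes on $[0,\infty)$ indexed by the points of $\mathbb{Z}^d$, that is, the Poisson point process on $\mathbb{R}^d \times [0,\infty)$ whose intensity is (counting measure on $\mathbb{Z}^d$) $\otimes$ (Lebesgue measure). For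 $\lambda > 0$ put $$\pi^+_{\lambda A} := \pi(\mathcal{P}_{\lambda A}) \setminus (\pi(\mathcal{P}) \cap \lambda A), \qquad \pi^-_{\lambda A} := (\pi(\mathcal{P}) \cap \lambda A) \setminus \pi(\mathcal{P}_{\lambda A}).$$ Then for every $\lambda > 0$ the number of points of each of $\pi^+_{\lambda A}$ and $\pi^-_{\lambda A}$ is an almost surely finite, square integrable random variable, and the mean and the variance of each of these two numbers are $O(\lambda^{d-1})$ as $\lambda \to \infty$. -/

import Mathlib

open MeasureTheory ProbabilityTheory Filter Asymptotics
open scoped Pointwise ENNReal NNReal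

noncomputable section

namespace RandomPacking

/-- A random subset `X` of `S` is a (simple) Poisson point process with intensity measure `m`:
counts on measurable sets are random variables, the count on a set of finite `m`-measure has the
Poisson law with parameter its `m`-measure, and counts on disjoint sets are independent. -/
structure IsPoissonPointProcess {Ω S : Type*} [MeasurableSpace Ω] [MeasurableSpace S]
    (X : Ω → Set S) (m : Measure S) (P : Measure Ω) : Prop where
  measurable_count : ∀ B : Set S, MeasurableSet B → Measurable fun ω => (X ω ∩ B).encard
  map_count : ∀ B : Set S, MeasurableSet B → m B ≠ ∞ →
    P.map (fun ω => (X ω ∩ B).encard) =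
      (poissonMeasure (m B).toNNReal).map (fun k : ℕ => (k : ℕ∞))
  indep_count : ∀ (n : ℕ) (B : Fin n → Set S), (∀ i, MeasurableSet (B i)) →
    Pairwise (fun i j => Disjoint (B i) (B j)) →
    iIndepFun (fun i ω => (X ω ∩ B i).encard) P

/-- Space-time: `w = (x, t)` is a ball with centre `x` that arrives at time `t`. -/
abbrev SpaceTime (d : ℕ) : Type := EuclideanSpace ℝ (Fin d) × ℝ

/-- Intensity of the continuum input: Lebesgue measure on `ℝ^d × [0, τ]`. -/
def continuumIntensity (d : ℕ) (τ : ℝ) : Measure (SpaceTime d) :=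
  (volume : Measure (EuclideanSpace ℝ (Fin d))).prod (volume.restrict (Set.Icc 0 τ))

/-- Intensity of the lattice input: (counting measure of `ℤ^d ⊆ ℝ^d`) times (Lebesgue measure on
`[0, ∞)`).  A Poisson process with this intensity is a family of independent rate one Poisson
processes on the half line, one above each lattice point. -/
def latticeIntensity (d : ℕ) : Measure (SpaceTime d) :=
  (Measure.sum fun z : Fin d → ℤ =>
    Measure.dirac (WithLp.toLp 2 fun i => (z i : ℝ) : EuclideanSpace ℝ (Fin d))).prod
    (volume.restrict (Set.Ici 0))

/-- The fate of the balls of the input `X` in the sequential packing of open unit balls.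
`Fate X w true`: the ball `w` is packed, because every earlier ball that overlaps it has been
discarded.  `Fate X w false`: the ball `w` is discarded, because it overlaps an earlier ball that
has been packed.  Two open unit balls overlap iff their centres are at distance less than `2`.
The fate of every ball from which there is no infinite chain of successively earlier overlapping
balls is decided in this way. -/
inductive Fate {d : ℕ} (X : Set (SpaceTime d)) : SpaceTime d → Bool → Prop
  | packed (w : SpaceTime d) (hw : w ∈ X)
      (h : ∀ v ∈ X, v.2 < w.2 → dist v.1 w.1 < 2 → Fate X v false) : Fate X w true
  | discarded (w v : SpaceTime d) (hw : w ∈ X) (hv : v ∈ X) (hlt : v.2 < w.2)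
      (hover : dist v.1 w.1 < 2) (h : Fate X v true) : Fate X w false

/-- `α(X)`: the balls of `X` that are accepted in the packing process with input `X`. -/
def accepted {d : ℕ} (X : Set (SpaceTime d)) : Set (SpaceTime d) :=
  {w | Fate X w true}

/-- `π(X)`: the centres of the accepted balls. -/
def packing {d : ℕ} (X : Set (SpaceTime d)) : Set (EuclideanSpace ℝ (Fin d)) :=
  Prod.fst '' accepted X

/-- `X_A`: the input restricted to balls with centre in `A`. -/
def restrictInput {d : ℕ} (X : Set (SpaceTime d)) (A : Set (EuclideanSpace ℝ (Fin d))) :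
    Set (SpaceTime d) :=
  {w ∈ X | w.1 ∈ A}

/-- The support of `π⁺_A`: points of the packing on `A` that are not in the infinite packing
restricted to `A`. -/
def excess {d : ℕ} (X : Set (SpaceTime d)) (A : Set (EuclideanSpace ℝ (Fin d))) :
    Set (EuclideanSpace ℝ (Fin d)) :=
  packing (restrictInput X A) \ (packing X ∩ A)

/-- The support of `π⁻_A`: points of the infinite packing restricted to `A` that are not in the
packing on `A`. -/
def deficit {d : ℕ} (X : Set (SpaceTime d)) (A : Set (EuclideanSpace ℝ (Fin d))) :
    Set (EuclideanSpace ℝ (Fin d)) :=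
  (packing X ∩ A) \ packing (restrictInput X A)

/-- The boundary of `A ⊆ ℝ^d` is a finite union of compact smooth pieces, each parametrized by a
compact set `K i ⊆ ℝ^(d-1)` through a map that is `C^1` in a neighbourhood of `K i`. -/
def HasPiecewiseSmoothBoundary {d : ℕ} (A : Set (EuclideanSpace ℝ (Fin d))) : Prop :=
  ∃ (n : ℕ) (K : Fin n → Set (EuclideanSpace ℝ (Fin (d - 1))))
    (f : Fin n → EuclideanSpace ℝ (Fin (d - 1)) → EuclideanSpace ℝ (Fin d)),
    (∀ i, IsCompact (K i) ∧ ∃ U, IsOpen U ∧ K i ⊆ U ∧ ContDiffOn ℝ 1 (f i) U) ∧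
    frontier A = ⋃ i, f i '' K i

/-- For a family `S r`, `r > 0`, of random point sets: the number of points of `S r` is an almost
surely finite, square integrable random variable, and its mean and its variance are
`O(r^k)` as `r → ∞`. -/
def MeanAndVarianceOfOrder {Ω E : Type*} [MeasurableSpace Ω] (P : Measure Ω)
    (S : ℝ → Ω → Set E) (k : ℕ) : Prop :=
  (∀ r : ℝ, 0 < r → (∀ᵐ ω ∂P, (S r ω).Finite) ∧ MemLp (fun ω => ((S r ω).ncard : ℝ)) 2 P) ∧
  (fun r : ℝ => ∫ ω, ((S r ω).ncard : ℝ) ∂P) =O[atTop] (fun r : ℝ => r ^ k) ∧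
  (fun r : ℝ => variance (fun ω => ((S r ω).ncard : ℝ)) P) =O[atTop] (fun r : ℝ => r ^ k)

end RandomPacking

end

namespace RandomPacking

section Fates

variable {d : ℕ}

/-! ### Deterministic facts on the packing process -/

/-! Cut space into cubes of side `1 / d`. Their diameter is at most 1, so almost surely a packing
has at most one centre in each cube (`IsRegularInput.unique`). The number of discrepancies is
therefore a sum of indicators of events `E z`, one per cube, and everything reduces to bounds on `P
(E z)` and on the covariances.

The fate of a ball depends only on the balls reachable through chains of successively earlier
overlapping balls (`fate_restrictInput_iff`). Since the arrival times along a chain are ordered, `n`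
steps below a ball that arrives by time `s` have probability at most `M ^ n (s + 1) ^ (n + 1) / (n +
1)!` (`IsPoissonPointProcess.measure_hasChain_le`), which is exponentially small for `s` a small
multiple of `n`. Later packed balls are exponentially rare: the continuum has a time horizon, and on
the lattice only a first arrival at a site can be packed. Hence, outside an event of exponentially
small probability, the packing in a cube is a function of the input within `n` steps
(`IsRegularInput.exists_localization`).

Two consequences follow. Far from the boundary the restriction to `A` changes nothing, so `P (E z)`
decays exponentially in the distance from `z` to the finite set `Z` of cubes covering the boundary.
By independence over disjoint regions, the covariance of `E z` and `E z'` is at most exponentially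
small in the distance of `z` and `z'`. It is also at most `P (E z)`, so it is at most the geometric
mean of the two bounds (`IsRegularInput.exists_cubeEvent_bounds`). Summing gives a mean and a
variance of order `Z.card`, and `Z.card` is of order `(r + 1) ^ (d - 1)` because the boundary
consists of Lipschitz images of compact sets in dimension `d - 1`
(`HasPiecewiseSmoothBoundary.exists_cells`). -/

theorem Fate.mem {X : Set (SpaceTime d)} {w : SpaceTime d} {b : Bool} (h : Fate X w b) :
    w ∈ X := by
  cases h <;> assumption

/-- Induction on the derivation of one fate: being packed needs every earlier overlapping ball
discarded, being discarded needs one of them packed, so a conflict at a ball passes to an earlier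
one. -/
theorem Fate.not_both {X : Set (SpaceTime d)} {w : SpaceTime d} {b : Bool} (h : Fate X w b) :
    ¬ Fate X w (!b) := by
  induction h with
  | packed w hw _ ih =>
    intro h'
    cases h' with
    | discarded _ v _ hv hlt hover h => exact ih v hv hlt hover h
  | discarded w v hw hv hlt hover _ ih =>
    intro h'
    cases h' with
    | packed _ _ h => exact ih (h v hv hlt hover)

/-- An earlier ball at the same centre would have to be discarded because of a packed ball `u`. But
`u` also overlaps `w` and precedes it, so `u` would have to be discarded too. On the lattice this
bounds the arrival time of a packed ball by the first arrival at its site. -/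
theorem Fate.time_le {X : Set (SpaceTime d)} {w v : SpaceTime d} (h : Fate X w true)
    (hv : v ∈ X) (hc : v.1 = w.1) : w.2 ≤ v.2 := by
  by_contra! hlt
  cases h with
  | packed _ hw h =>
    have h1 := h v hv hlt (by rw [hc, dist_self]; norm_num)
    cases h1 with
    | discarded _ u _ hu hlt' hover hu' =>
      exact hu'.not_both (h u hu (hlt'.trans hlt) (by rwa [← hc]))

/-- Neither ball can precede the other, since the later one would be discarded. Simultaneous
arrivals are excluded only almost surely, in `IsPoissonPointProcess.ae_no_ties`. -/
theorem Fate.time_eq {X : Set (SpaceTime d)} {w v : SpaceTime d} (hw : Fate X w true)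
    (hv : Fate X v true) (hc : dist v.1 w.1 < 2) : w.2 = v.2 := by
  have key : ∀ {w v : SpaceTime d}, Fate X w true → Fate X v true → dist v.1 w.1 < 2 →
      w.2 ≤ v.2 := by
    intro w v hw hv hc
    by_contra! hlt
    cases hw with
    | packed _ _ h => exact hv.not_both (h v hv.mem hlt hc)
  exact le_antisymm (key hw hv hc) (key hv hw (by rwa [dist_comm]))

theorem Fate.eq_of_fst_eq {X : Set (SpaceTime d)} {w v : SpaceTime d} (hw : Fate X w true)
    (hv : Fate X v true) (hc : v.1 = w.1) : v = w :=
  Prod.ext hc (le_antisymm (hv.time_le hw.mem hc.symm) (hw.time_le hv.mem hc))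

/-- The index of the grid cube of side `1 / d` that contains `x`. -/
noncomputable def cell (x : EuclideanSpace ℝ (Fin d)) : Fin d → ℤ := fun i => ⌊(d : ℝ) * x i⌋

/-- One step of a chain moves each cube index by at most `2 * d`; this is the unit in which `nearby`
measures distance. -/
theorem dist_cell_le {x y : EuclideanSpace ℝ (Fin d)} (h : dist x y < 2) :
    dist (cell x) (cell y) ≤ 2 * d := by
  rw [dist_pi_le_iff (by positivity)]
  intro i
  have hd : (0 : ℝ) < d := by exact_mod_cast (Fin.pos i)
  have h1 : |x i - y i| < 2 := by
    have := PiLp.norm_apply_le (x - y) i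
    rw [dist_eq_norm] at h
    simpa using this.trans_lt h
  have h2 : |(d : ℝ) * x i - d * y i| < 2 * d := by
    rw [← mul_sub, abs_mul, abs_of_pos hd]; nlinarith
  rw [Int.dist_eq, cell, cell]
  have h3 : |⌊(d : ℝ) * x i⌋ - ⌊(d : ℝ) * y i⌋| < 2 * d + 1 := by
    rw [abs_lt] at h2 ⊢
    have a1 := Int.floor_le ((d : ℝ) * x i)
    have a2 := Int.lt_floor_add_one ((d : ℝ) * x i)
    have b1 := Int.floor_le ((d : ℝ) * y i)
    have b2 := Int.lt_floor_add_one ((d : ℝ) * y i)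
    constructor
    · have : (-(2 * d + 1 : ℤ) : ℝ) < ((⌊(d : ℝ) * x i⌋ - ⌊(d : ℝ) * y i⌋ : ℤ) : ℝ) := by
        push_cast; linarith
      exact_mod_cast this
    · have : ((⌊(d : ℝ) * x i⌋ - ⌊(d : ℝ) * y i⌋ : ℤ) : ℝ) < ((2 * d + 1 : ℤ) : ℝ) := by
        push_cast; linarith
      exact_mod_cast this
  have h4 : |⌊(d : ℝ) * x i⌋ - ⌊(d : ℝ) * y i⌋| ≤ 2 * d := by omega
  exact_mod_cast h4

theorem dist_lt_two_of_cell_eq {x y : EuclideanSpace ℝ (Fin d)} (h : cell x = cell y) :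
    dist x y < 2 := by
  rcases Nat.eq_zero_or_pos d with rfl | hd
  · rw [Subsingleton.elim x y, dist_self]; norm_num
  have hd' : (1 : ℝ) ≤ d := by exact_mod_cast hd
  rw [EuclideanSpace.dist_eq]
  have h1 : ∀ i, dist (x i) (y i) ^ 2 ≤ 1 / d := by
    intro i
    have h2 : |(d : ℝ) * x i - d * y i| < 1 := Int.abs_sub_lt_one_of_floor_eq_floor (congrFun h i)
    rw [← mul_sub, abs_mul, abs_of_pos (by linarith : (0 : ℝ) < d)] at h2
    have h3 : |x i - y i| ≤ 1 / d := by
      rw [le_div_iff₀ (by linarith)]; linarith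
    have h4 : (1 : ℝ) / d ≤ 1 := by rw [div_le_one (by linarith)]; exact hd'
    rw [Real.dist_eq]
    nlinarith [abs_nonneg (x i - y i)]
  have h5 : ∑ i, dist (x i) (y i) ^ 2 ≤ 1 := by
    calc _ ≤ ∑ _i : Fin d, (1 : ℝ) / d := Finset.sum_le_sum fun i _ => h1 i
      _ = 1 := by simp; field_simp
  calc _ ≤ √1 := Real.sqrt_le_sqrt h5
    _ < 2 := by norm_num

/-- There are `n` successively earlier overlapping balls of `X` below the ball `w` of `X`. -/
def HasChain (X : Set (SpaceTime d)) : ℕ → SpaceTime d → Prop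
  | 0, w => w ∈ X
  | n + 1, w => w ∈ X ∧ ∃ v ∈ X, v.2 < w.2 ∧ dist v.1 w.1 < 2 ∧ HasChain X n v

theorem HasChain.mono {X Y : Set (SpaceTime d)} (h : X ⊆ Y) {n : ℕ} {w : SpaceTime d}
    (hw : HasChain X n w) : HasChain Y n w := by
  induction n generalizing w with
  | zero => exact h hw
  | succ n ih =>
    obtain ⟨h1, v, hv, hlt, ho, hc⟩ := hw
    exact ⟨h h1, v, h hv, hlt, ho, ih hc⟩

theorem restrictInput_subset (X : Set (SpaceTime d)) (A : Set (EuclideanSpace ℝ (Fin d))) :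
    restrictInput X A ⊆ X := fun _ h => h.1

theorem restrictInput_restrictInput (X : Set (SpaceTime d))
    (A B : Set (EuclideanSpace ℝ (Fin d))) :
    restrictInput (restrictInput X A) B = restrictInput X (A ∩ B) := by
  ext w; simp [restrictInput, and_assoc]

theorem restrictInput_univ (X : Set (SpaceTime d)) : restrictInput X Set.univ = X := by
  ext w; simp [restrictInput]

/-- The union of the grid cubes at distance at most `n` steps from the grid cube `z`. -/
def nearby (n : ℕ) (z : Fin d → ℤ) : Set (EuclideanSpace ℝ (Fin d)) :=
  {y | dist (cell y) z ≤ 2 * d * n}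

/-- Every ball that influences `w` is reached by fewer than `n` chain steps, hence lies within `n`
steps of its cube. In the induction an earlier overlapping ball has one step less in its chains, and
its smaller neighbourhood still fits into `B`. -/
theorem fate_restrictInput_iff {X : Set (SpaceTime d)} {B : Set (EuclideanSpace ℝ (Fin d))}
    {n : ℕ} {w : SpaceTime d} {b : Bool} (hc : ¬ HasChain X n w) (hw : w ∈ X)
    (hB : nearby n (cell w.1) ⊆ B) :
    Fate (restrictInput X B) w b ↔ Fate X w b := by
  induction n generalizing w b with
  | zero => exact absurd hw hc
  | succ n ih =>
    have hwB : w.1 ∈ B := hB (by simp [nearby]; positivity)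
    have key : ∀ v ∈ X, v.2 < w.2 → dist v.1 w.1 < 2 →
        v ∈ restrictInput X B ∧ ∀ b, (Fate (restrictInput X B) v b ↔ Fate X v b) := by
      intro v hv hlt ho
      have h1 := dist_cell_le ho
      have h2 : nearby n (cell v.1) ⊆ B := by
        intro y hy
        refine hB ?_
        have hy' : dist (cell y) (cell v.1) ≤ 2 * d * n := hy
        change dist (cell y) (cell w.1) ≤ 2 * d * ((n + 1 : ℕ) : ℝ)
        push_cast
        linarith [dist_triangle (cell y) (cell v.1) (cell w.1)]
      have h3 : ¬ HasChain X n v := fun h => hc ⟨hw, v, hv, hlt, ho, h⟩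
      refine ⟨⟨hv, h2 ?_⟩, fun b => ih h3 hv h2⟩
      simp [nearby]; positivity
    constructor
    · intro h
      cases h with
      | packed _ hw' h =>
        exact .packed _ hw fun v hv hlt ho =>
          ((key v hv hlt ho).2 _).1 (h v (key v hv hlt ho).1 hlt ho)
      | discarded _ v hw' hv hlt ho h =>
        exact .discarded _ v hw hv.1 hlt ho (((key v hv.1 hlt ho).2 _).1 h)
    · intro h
      cases h with
      | packed _ hw' h =>
        exact .packed _ ⟨hw, hwB⟩ fun v hv hlt ho =>
          ((key v hv.1 hlt ho).2 _).2 (h v hv.1 hlt ho)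
      | discarded _ v hw' hv hlt ho h =>
        exact .discarded _ v ⟨hw, hwB⟩ (key v hv hlt ho).1 hlt ho (((key v hv hlt ho).2 _).2 h)

/-- The space-time region of the balls with centre in the grid cube `z` that arrive up to
time `k`. -/
def cellUpTo (z : Fin d → ℤ) (k : ℕ) : Set (SpaceTime d) := {w | cell w.1 = z ∧ w.2 ≤ k}

/-- Only finitely many balls arrive in each grid cube up to each time. -/
def LocallyFinite (X : Set (SpaceTime d)) : Prop := ∀ z k, (X ∩ cellUpTo z k).Finite

theorem LocallyFinite.mono {X Y : Set (SpaceTime d)} (h : X ⊆ Y) (hY : LocallyFinite Y) :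
    LocallyFinite X := fun z k => (hY z k).subset (Set.inter_subset_inter_left _ h)

theorem LocallyFinite.finite_below {X : Set (SpaceTime d)} (hX : LocallyFinite X)
    (w : SpaceTime d) : {v ∈ X | v.2 < w.2 ∧ dist v.1 w.1 < 2}.Finite := by
  obtain ⟨k, hk⟩ := exists_nat_ge w.2
  have h1 : (Metric.closedBall (cell w.1) (2 * d)).Finite :=
    (isCompact_closedBall _ _).finite_of_discrete
  refine (h1.biUnion fun z _ => hX z k).subset ?_
  rintro v ⟨hv, hlt, ho⟩
  simp only [Set.mem_iUnion]
  exact ⟨cell v.1, by simpa using dist_cell_le ho, hv, rfl, hlt.le.trans hk⟩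

/-- The fates that are decided within `n` steps. -/
def FateWithin (X : Set (SpaceTime d)) : ℕ → SpaceTime d → Bool → Prop
  | 0, _, _ => False
  | n + 1, w, true =>
      w ∈ X ∧ ¬ ∃ v ∈ X, v.2 < w.2 ∧ dist v.1 w.1 < 2 ∧ ¬ FateWithin X n v false
  | n + 1, w, false => w ∈ X ∧ ∃ v ∈ X, v.2 < w.2 ∧ dist v.1 w.1 < 2 ∧ FateWithin X n v true

theorem FateWithin.succ {X : Set (SpaceTime d)} {n : ℕ} {w : SpaceTime d} {b : Bool}
    (h : FateWithin X n w b) : FateWithin X (n + 1) w b := by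
  induction n generalizing w b with
  | zero => exact h.elim
  | succ n ih =>
    cases b with
    | true =>
      refine ⟨h.1, ?_⟩
      rintro ⟨v, hv, hlt, ho, hn⟩
      exact h.2 ⟨v, hv, hlt, ho, fun h' => hn (ih h')⟩
    | false =>
      obtain ⟨hw, v, hv, hlt, ho, h'⟩ := h
      exact ⟨hw, v, hv, hlt, ho, ih h'⟩

theorem FateWithin.mono {X : Set (SpaceTime d)} {n k : ℕ} (hnk : n ≤ k) {w : SpaceTime d}
    {b : Bool} (h : FateWithin X n w b) : FateWithin X k w b := by
  induction hnk with
  | refl => exact h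
  | step _ ih => exact ih.succ

theorem FateWithin.fate {X : Set (SpaceTime d)} {n : ℕ} {w : SpaceTime d} {b : Bool}
    (h : FateWithin X n w b) : Fate X w b := by
  induction n generalizing w b with
  | zero => exact h.elim
  | succ n ih =>
    cases b with
    | true =>
      refine .packed _ h.1 fun v hv hlt ho => ?_
      by_contra hn
      exact h.2 ⟨v, hv, hlt, ho, fun h' => hn (ih h')⟩
    | false =>
      obtain ⟨hw, v, hv, hlt, ho, h'⟩ := h
      exact .discarded _ v hw hv hlt ho (ih h')

/-- Only finitely many balls are earlier than and overlap a given one, so the maximum of the numbers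
of steps they need is finite. This writes fate as a countable union of explicit conditions, as
measurability requires. -/
theorem LocallyFinite.fate_iff {X : Set (SpaceTime d)} (hX : LocallyFinite X) {w : SpaceTime d}
    {b : Bool} : Fate X w b ↔ ∃ n, FateWithin X n w b := by
  refine ⟨fun h => ?_, fun ⟨n, h⟩ => h.fate⟩
  induction h with
  | packed w hw _ ih =>
    choose! N hN using ih
    obtain ⟨n, hn⟩ := ((hX.finite_below w).image N).bddAbove
    refine ⟨n + 1, hw, ?_⟩
    rintro ⟨v, hv, hlt, ho, h⟩
    exact h ((hN v hv hlt ho).mono (hn ⟨v, ⟨hv, hlt, ho⟩, rfl⟩))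
  | discarded w v hw hv hlt ho _ ih =>
    obtain ⟨n, hn⟩ := ih
    exact ⟨n + 1, hw, v, hv, hlt, ho, hn⟩

end Fates

section Measurability

/-! ### Measurability -/

/-- The number of points of the random set `Y` in a measurable set is a random variable. -/
def MeasurableCounts {T S : Type*} [MeasurableSpace T] [MeasurableSpace S] (Y : T → Set S) :
    Prop :=
  ∀ B : Set S, MeasurableSet B → Measurable fun t => (Y t ∩ B).encard

/-! ### Measurability of hitting events -/

section Hit

variable {T S : Type*} [MeasurableSpace T] [MeasurableSpace S] [MeasurableSingletonClass S]

/-- On the event of exactly `k` points in `c`, counting measure on these points is a kernel of mass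
`k`; off the event it is set to zero. Measurability of the mass of sections of `G` then comes from
kernel theory, and a section is hit iff its mass is nonzero. Fixing `k` makes the kernel finite. -/
theorem MeasurableCounts.measurableSet_hit_of_encard_eq {Y : T → Set S} (hY : MeasurableCounts Y)
    {c : Set S} (hc : MeasurableSet c) (k : ℕ) {G : Set (T × S)} (hG : MeasurableSet G) :
    MeasurableSet {t | (Y t ∩ c).encard = k ∧ (Y t ∩ c ∩ {s | (t, s) ∈ G}).Nonempty} := by
  classical
  have happly : ∀ t B, MeasurableSet B →
      (if (Y t ∩ c).encard = k then (Measure.count.restrict (Y t ∩ c) : Measure S) else 0) B =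
        if (Y t ∩ c).encard = k then ((Y t ∩ (c ∩ B)).encard : ℝ≥0∞) else 0 := by
    intro t B hB
    split_ifs with h
    · have hfin : (Y t ∩ c).Finite := Set.finite_of_encard_eq_coe h
      rw [Measure.restrict_apply hB, Measure.count_apply (hB.inter hfin.measurableSet),
        Set.inter_comm B, Set.inter_assoc]
    · simp
  have hev : MeasurableSet {t | (Y t ∩ c).encard = k} :=
    hY c hc (measurableSet_singleton (k : ℕ∞))
  let κ : Kernel T S :=
    { toFun := fun t =>
        if (Y t ∩ c).encard = k then (Measure.count.restrict (Y t ∩ c) : Measure S) else 0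
      measurable' := by
        refine Measure.measurable_of_measurable_coe _ fun B hB => ?_
        simp_rw [happly _ B hB]
        refine Measurable.ite hev ?_ measurable_const
        exact (measurable_of_countable (fun n : ℕ∞ => (n : ℝ≥0∞))).comp (hY _ (hc.inter hB)) }
  have hκ : ∀ t B, MeasurableSet B →
      κ t B = if (Y t ∩ c).encard = k then ((Y t ∩ (c ∩ B)).encard : ℝ≥0∞) else 0 := happly
  have : IsFiniteKernel κ := ⟨⟨k, by simp, fun t => by
    rw [hκ _ _ MeasurableSet.univ]
    split_ifs with h
    · rw [Set.inter_univ, h]; simp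
    · simp⟩⟩
  have hm : Measurable fun t => κ t (Prod.mk t ⁻¹' G) := Kernel.measurable_kernel_prodMk_left hG
  have : {t | (Y t ∩ c).encard = k ∧ (Y t ∩ c ∩ {s | (t, s) ∈ G}).Nonempty} =
      {t | κ t (Prod.mk t ⁻¹' G) ≠ 0} := by
    ext t
    have hG' : MeasurableSet (Prod.mk t ⁻¹' G) := measurable_prodMk_left hG
    simp only [Set.mem_ofPred_eq, hκ t _ hG', ne_eq, ite_eq_right_iff, Classical.not_imp]
    refine and_congr_right fun _ => ?_
    rw [← Set.inter_assoc]
    simp only [ENat.toENNReal_eq_zero, Set.encard_eq_zero, ← ne_eq, ← Set.nonempty_iff_ne_empty]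
    rfl
  rw [this]
  exact hm (measurableSet_singleton 0).compl

theorem MeasurableCounts.measurableSet_hit {ι : Type*} [Countable ι] {Y : T → Set S}
    (hY : MeasurableCounts Y) {c : ι → Set S} (hc : ∀ i, MeasurableSet (c i))
    (hcov : ∀ s, ∃ i, s ∈ c i) (hfin : ∀ t i, (Y t ∩ c i).Finite) {G : Set (T × S)}
    (hG : MeasurableSet G) : MeasurableSet {t | ∃ s ∈ Y t, (t, s) ∈ G} := by
  have : {t | ∃ s ∈ Y t, (t, s) ∈ G} =
      ⋃ i, ⋃ k : ℕ, {t | (Y t ∩ c i).encard = k ∧ (Y t ∩ c i ∩ {s | (t, s) ∈ G}).Nonempty} := by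
    ext t
    simp only [Set.mem_ofPred_eq, Set.mem_iUnion]
    constructor
    · rintro ⟨s, hs, hsG⟩
      obtain ⟨i, hi⟩ := hcov s
      exact ⟨i, (hfin t i).toFinset.card, (hfin t i).encard_eq_coe_toFinset_card, s, ⟨hs, hi⟩, hsG⟩
    · rintro ⟨i, k, -, s, ⟨hs, -⟩, hsG⟩
      exact ⟨s, hs, hsG⟩
  rw [this]
  exact .iUnion fun i => .iUnion fun k => hY.measurableSet_hit_of_encard_eq (hc i) k hG

end Hit

variable {d : ℕ}

theorem measurable_cell : Measurable (cell : EuclideanSpace ℝ (Fin d) → Fin d → ℤ) := by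
  refine measurable_pi_lambda _ fun i => ?_
  unfold cell
  fun_prop

theorem measurableSet_cellUpTo (z : Fin d → ℤ) (k : ℕ) : MeasurableSet (cellUpTo z k) :=
  (measurable_cell.comp measurable_fst (measurableSet_singleton z)).inter
    (measurable_snd measurableSet_Iic)

variable {T : Type*} [MeasurableSpace T] {Y : T → Set (SpaceTime d)}

theorem MeasurableCounts.measurableSet_exists (hY : MeasurableCounts Y)
    (hfin : ∀ t, LocallyFinite (Y t)) {G : Set (T × SpaceTime d)} (hG : MeasurableSet G) :
    MeasurableSet {t | ∃ s ∈ Y t, (t, s) ∈ G} :=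
  hY.measurableSet_hit (c := fun i : (Fin d → ℤ) × ℕ => cellUpTo i.1 i.2)
    (fun _ => measurableSet_cellUpTo _ _)
    (fun s => ⟨(cell s.1, ⌈s.2⌉₊), rfl, Nat.le_ceil _⟩) (fun t _ => hfin t _ _) hG

theorem MeasurableCounts.measurableSet_exists_pair (hY : MeasurableCounts Y)
    (hfin : ∀ t, LocallyFinite (Y t)) {G : Set ((T × SpaceTime d) × SpaceTime d)}
    (hG : MeasurableSet G) : MeasurableSet {p : T × SpaceTime d | ∃ s ∈ Y p.1, (p, s) ∈ G} :=
  MeasurableCounts.measurableSet_exists (Y := fun p : T × SpaceTime d => Y p.1)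
    (fun B hB => (hY B hB).comp measurable_fst) (fun p => hfin p.1) hG

theorem MeasurableCounts.measurableSet_mem (hY : MeasurableCounts Y)
    (hfin : ∀ t, LocallyFinite (Y t)) : MeasurableSet {p : T × SpaceTime d | p.2 ∈ Y p.1} := by
  have := hY.measurableSet_exists_pair hfin (G := {q | q.2 = q.1.2})
    (measurableSet_eq_fun measurable_snd (measurable_snd.comp measurable_fst))
  simpa using this

theorem measurableSet_earlier_overlapping :
    MeasurableSet {q : (T × SpaceTime d) × SpaceTime d |
      q.2.2 < q.1.2.2 ∧ dist q.2.1 q.1.2.1 < 2} := by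
  have h1 : MeasurableSet {q : (T × SpaceTime d) × SpaceTime d | q.2.2 < q.1.2.2} :=
    measurableSet_lt (measurable_snd.comp measurable_snd)
      (measurable_snd.comp (measurable_snd.comp measurable_fst))
  have h2 : MeasurableSet {q : (T × SpaceTime d) × SpaceTime d | dist q.2.1 q.1.2.1 < 2} :=
    measurableSet_lt ((measurable_fst.comp measurable_snd).dist
      (measurable_fst.comp (measurable_snd.comp measurable_fst))) measurable_const
  exact h1.inter h2

/-- Each level is an existential over the points of the random set or the negation of one, which is
why `FateWithin` phrases its universal condition as a negated existential. -/
theorem MeasurableCounts.measurableSet_fateWithin (hY : MeasurableCounts Y)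
    (hfin : ∀ t, LocallyFinite (Y t)) (n : ℕ) (b : Bool) :
    MeasurableSet {p : T × SpaceTime d | FateWithin (Y p.1) n p.2 b} := by
  have hmap : Measurable fun q : (T × SpaceTime d) × SpaceTime d => (q.1.1, q.2) := by fun_prop
  induction n generalizing b with
  | zero => simp [FateWithin]
  | succ n ih =>
    cases b with
    | true =>
      have := hY.measurableSet_exists_pair hfin
        (measurableSet_earlier_overlapping.inter (hmap (ih false).compl))
      convert (hY.measurableSet_mem hfin).inter this.compl using 1
      ext p
      simp [FateWithin, and_assoc]
    | false =>
      have := hY.measurableSet_exists_pair hfin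
        (measurableSet_earlier_overlapping.inter (hmap (ih true)))
      convert (hY.measurableSet_mem hfin).inter this using 1
      ext p
      simp [FateWithin, and_assoc]

theorem MeasurableCounts.measurableSet_fate (hY : MeasurableCounts Y)
    (hfin : ∀ t, LocallyFinite (Y t)) (b : Bool) :
    MeasurableSet {p : T × SpaceTime d | Fate (Y p.1) p.2 b} := by
  convert MeasurableSet.iUnion fun n => hY.measurableSet_fateWithin hfin n b using 1
  ext p
  simp [(hfin p.1).fate_iff]

theorem MeasurableCounts.measurableSet_packing_diff {Y' : T → Set (SpaceTime d)}
    (hY : MeasurableCounts Y) (hfin : ∀ t, LocallyFinite (Y t)) (hY' : MeasurableCounts Y')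
    (hfin' : ∀ t, LocallyFinite (Y' t)) {C : Set (EuclideanSpace ℝ (Fin d))}
    (hC : MeasurableSet C) :
    MeasurableSet {t | ((C ∩ packing (Y t)) \ packing (Y' t)).Nonempty} := by
  have hmap : Measurable fun q : (T × SpaceTime d) × SpaceTime d => (q.1.1, q.2) := by fun_prop
  have h0 : MeasurableSet {q : (T × SpaceTime d) × SpaceTime d | q.2.1 = q.1.2.1} :=
    measurableSet_eq_fun (measurable_fst.comp measurable_snd)
      (measurable_fst.comp (measurable_snd.comp measurable_fst))
  have h1 := hY'.measurableSet_exists_pair hfin'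
    (h0.inter (hmap (hY'.measurableSet_fate hfin' true)))
  have h2 := hY.measurableSet_exists hfin
    (((hY.measurableSet_fate hfin true).inter h1.compl).inter
      (measurable_fst.comp measurable_snd hC))
  convert h2 using 1
  ext t
  simp only [Set.Nonempty, packing, accepted, Set.mem_sdiff, Set.mem_inter_iff, Set.mem_image,
    Set.mem_ofPred_eq, Set.mem_compl_iff, Set.mem_preimage, Function.comp]
  constructor
  · rintro ⟨x, ⟨hx, w, hw, rfl⟩, hn⟩
    exact ⟨w, hw.mem, ⟨hw, fun ⟨v, _, hv, hf⟩ => hn ⟨v, hf, hv⟩⟩, hx⟩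
  · rintro ⟨w, _, ⟨hw, hn⟩, hx⟩
    exact ⟨w.1, ⟨hx, w, hw, rfl⟩, fun ⟨v, hf, hv⟩ => hn ⟨v, hf.mem, hv, hf⟩⟩

theorem MeasurableCounts.measurableSet_locallyFinite (hY : MeasurableCounts Y) :
    MeasurableSet {t | LocallyFinite (Y t)} := by
  simp only [LocallyFinite, Set.ofPred_forall]
  refine .iInter fun z => .iInter fun k => ?_
  have : {t | (Y t ∩ cellUpTo z k).Finite} = {t | (Y t ∩ cellUpTo z k).encard < ⊤} := by
    simp [Set.encard_lt_top_iff]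
  rw [this]
  exact hY _ (measurableSet_cellUpTo z k) (MeasurableSet.of_discrete (s := Set.Iio ⊤))

open Classical in
/-- The input `X`, replaced by the empty input where it is not locally finite. -/
noncomputable def regularize (X : Set (SpaceTime d)) : Set (SpaceTime d) :=
  if LocallyFinite X then X else ∅

theorem locallyFinite_regularize (X : Set (SpaceTime d)) : LocallyFinite (regularize X) := by
  unfold regularize
  split_ifs with h
  · exact h
  · intro z k; simp

theorem LocallyFinite.regularize_eq {X : Set (SpaceTime d)} (h : LocallyFinite X) :
    regularize X = X := if_pos h

theorem MeasurableCounts.regularize (hY : MeasurableCounts Y) :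
    MeasurableCounts fun t => regularize (Y t) := by
  classical
  intro B hB
  have : (fun t => (RandomPacking.regularize (Y t) ∩ B).encard) =
      fun t => if LocallyFinite (Y t) then (Y t ∩ B).encard else 0 := by
    ext1 t
    unfold RandomPacking.regularize
    split_ifs <;> simp
  rw [this]
  exact Measurable.ite hY.measurableSet_locallyFinite (hY B hB) measurable_const

theorem restrictInput_inter (X B : Set (SpaceTime d)) (R : Set (EuclideanSpace ℝ (Fin d))) :
    restrictInput X R ∩ B = X ∩ (Prod.fst ⁻¹' R ∩ B) := by
  ext w; simp [restrictInput, and_assoc]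

theorem MeasurableCounts.restrictInput (hY : MeasurableCounts Y)
    {R : Set (EuclideanSpace ℝ (Fin d))} (hR : MeasurableSet R) :
    MeasurableCounts fun t => restrictInput (Y t) R := by
  intro B hB
  simp_rw [restrictInput_inter]
  exact hY _ ((measurable_fst hR).inter hB)

end Measurability

/-! ### Independence of disjoint regions -/

section Independence

variable {Ω S : Type*} [MeasurableSpace S]

/-- The σ-algebra generated by the numbers of points of `X` in the measurable parts of `R`. -/
@[reducible] noncomputable def countsAlgebra (X : Ω → Set S) (R : Set S) : MeasurableSpace Ω :=
  ⨆ B : {B : Set S // MeasurableSet B},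
    MeasurableSpace.comap (fun ω => (X ω ∩ (R ∩ B)).encard) ⊤

theorem measurable_countsAlgebra (X : Ω → Set S) (R : Set S) {B : Set S} (hB : MeasurableSet B) :
    Measurable[countsAlgebra X R] fun ω => (X ω ∩ (R ∩ B)).encard :=
  measurable_iff_comap_le.2 (le_iSup (fun B : {B : Set S // MeasurableSet B} =>
    MeasurableSpace.comap (fun ω => (X ω ∩ (R ∩ B)).encard) ⊤) ⟨B, hB⟩)

theorem countsAlgebra_le [mΩ : MeasurableSpace Ω] {X : Ω → Set S} (hX : MeasurableCounts X) {R : Set S}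
    (hR : MeasurableSet R) : countsAlgebra X R ≤ mΩ :=
  iSup_le fun B => measurable_iff_comap_le.1 (hX _ (hR.inter B.2))

theorem countsAlgebra_mono (X : Ω → Set S) {R R' : Set S} (hR : MeasurableSet R) (h : R ⊆ R') :
    countsAlgebra X R ≤ countsAlgebra X R' := by
  refine iSup_le fun B => measurable_iff_comap_le.1 ?_
  have := measurable_countsAlgebra X R' (hR.inter B.2)
  rwa [← Set.inter_assoc, Set.inter_eq_self_of_subset_right h] at this

/-- The finite measurable labellings of `S`. -/
def Labelling (S : Type*) [MeasurableSpace S] : Type _ :=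
  Σ N : ℕ, {g : S → Fin N // Measurable g}

/-- The σ-algebra generated by the numbers of points of `X` in `R` with a given label. -/
@[reducible] noncomputable def labelAlgebra (X : Ω → Set S) (R : Set S) (g : Labelling S) : MeasurableSpace Ω :=
  ⨆ j : Fin g.1, MeasurableSpace.comap (fun ω => (X ω ∩ (R ∩ g.2.1 ⁻¹' {j})).encard) ⊤

/-- The Poisson axioms give independence only for counts on disjoint sets. A labelling cuts `R` into
finitely many disjoint pieces, so this presents the σ-algebra through subalgebras to which the
axioms apply. -/
theorem countsAlgebra_eq_iSup (X : Ω → Set S) (R : Set S) :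
    countsAlgebra X R = ⨆ g : Labelling S, labelAlgebra X R g := by
  classical
  apply le_antisymm
  · refine iSup_le fun B => ?_
    let g : S → Fin 2 := fun s => if s ∈ B.1 then 1 else 0
    have hg : Measurable g := Measurable.ite B.2 measurable_const measurable_const
    have hgB : g ⁻¹' {1} = B.1 := by
      ext s
      simp [g]
    refine le_iSup_of_le (⟨2, g, hg⟩ : Labelling S) (le_iSup_of_le (1 : Fin 2) ?_)
    change _ ≤ MeasurableSpace.comap (fun ω => (X ω ∩ (R ∩ g ⁻¹' {1})).encard) ⊤
    rw [hgB]
  · refine iSup_le fun g => iSup_le fun j => ?_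
    exact measurable_iff_comap_le.1
      (measurable_countsAlgebra X R (g.2.2 (measurableSet_singleton j)))

theorem encard_inter_eq_sum {S : Type*} {N : ℕ} (g : S → Fin N) (X B : Set S) :
    (X ∩ B).encard = ∑ j, (X ∩ (B ∩ g ⁻¹' {j})).encard := by
  rw [← finsum_eq_sum_of_fintype, ← Set.encard_iUnion_of_finite]
  · congr 1
    ext s
    simp
  · intro i j hij
    refine Set.disjoint_left.2 ?_
    rintro s ⟨-, -, rfl⟩ ⟨-, -, hj⟩
    exact hij hj

/-- The product of two labellings refines both, and a coarse count is a finite sum of fine counts.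
-/
theorem directed_labelAlgebra (X : Ω → Set S) (R : Set S) :
    Directed (· ≤ ·) (labelAlgebra X R) := by
  intro g h
  let q : S → Fin (g.1 * h.1) := fun s => finProdFinEquiv (g.2.1 s, h.2.1 s)
  have hq : Measurable q :=
    (measurable_of_countable finProdFinEquiv).comp (g.2.2.prodMk h.2.2)
  have hm : ∀ i j, Measurable[labelAlgebra X R ⟨_, q, hq⟩]
      fun ω => (X ω ∩ (R ∩ (g.2.1 ⁻¹' {i} ∩ h.2.1 ⁻¹' {j}))).encard := by
    intro i j
    have : g.2.1 ⁻¹' {i} ∩ h.2.1 ⁻¹' {j} = q ⁻¹' {finProdFinEquiv (i, j)} := by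
      ext s
      simp [q]
    rw [this]
    exact measurable_iff_comap_le.2 (le_iSup (fun j : Fin (g.1 * h.1) =>
      MeasurableSpace.comap (fun ω => (X ω ∩ (R ∩ q ⁻¹' {j})).encard) ⊤) _)
  refine ⟨⟨_, q, hq⟩, iSup_le fun i => measurable_iff_comap_le.1 ?_,
    iSup_le fun j => measurable_iff_comap_le.1 ?_⟩
  · rw [show (fun ω => (X ω ∩ (R ∩ g.2.1 ⁻¹' {i})).encard) = fun ω => ∑ j,
      (X ω ∩ (R ∩ (g.2.1 ⁻¹' {i} ∩ h.2.1 ⁻¹' {j}))).encard by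
        ext1 ω; rw [encard_inter_eq_sum h.2.1]; simp only [Set.inter_assoc]]
    exact Finset.measurable_sum _ fun j _ => hm i j
  · rw [show (fun ω => (X ω ∩ (R ∩ h.2.1 ⁻¹' {j})).encard) = fun ω => ∑ i,
      (X ω ∩ (R ∩ (g.2.1 ⁻¹' {i} ∩ h.2.1 ⁻¹' {j}))).encard by
        ext1 ω; rw [encard_inter_eq_sum g.2.1]
        simp only [Set.inter_assoc, Set.inter_comm (h.2.1 ⁻¹' _)]]
    exact Finset.measurable_sum _ fun i _ => hm i j

theorem labelAlgebra_le_countsAlgebra (X : Ω → Set S) (R : Set S) (g : Labelling S) :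
    labelAlgebra X R g ≤ countsAlgebra X R := by
  rw [countsAlgebra_eq_iSup]
  exact le_iSup _ g

variable [mΩ : MeasurableSpace Ω] {X : Ω → Set S} {m : Measure S} {P : Measure Ω}

theorem IsPoissonPointProcess.measurableCounts (hX : IsPoissonPointProcess X m P) :
    MeasurableCounts X := hX.measurable_count

/-- The pieces of `R` and those of `R'` together form one finite disjoint family; grouping its
independent counts into two blocks gives the claim. -/
theorem IsPoissonPointProcess.indep_labelAlgebra (hX : IsPoissonPointProcess X m P)
    {R R' : Set S} (hR : MeasurableSet R) (hR' : MeasurableSet R') (hd : Disjoint R R')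
    (g h : Labelling S) : Indep (labelAlgebra X R g) (labelAlgebra X R' h) P := by
  let B : Fin (g.1 + h.1) → Set S :=
    Fin.addCases (fun i => R ∩ g.2.1 ⁻¹' {i}) (fun j => R' ∩ h.2.1 ⁻¹' {j})
  have hB : ∀ i, MeasurableSet (B i) := by
    intro i
    induction i using Fin.addCases with
    | left i => simpa [B] using hR.inter (g.2.2 (measurableSet_singleton i))
    | right j => simpa [B] using hR'.inter (h.2.2 (measurableSet_singleton j))
  have hBd : Pairwise fun i j => Disjoint (B i) (B j) := by
    intro i j hij
    induction i using Fin.addCases with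
    | left i =>
      induction j using Fin.addCases with
      | left j =>
        simp only [B, Fin.addCases_left]
        refine Set.disjoint_left.2 ?_
        rintro s ⟨-, rfl⟩ ⟨-, hj⟩
        exact hij (congrArg _ hj)
      | right j =>
        simp only [B, Fin.addCases_left, Fin.addCases_right]
        exact hd.mono Set.inter_subset_left Set.inter_subset_left
    | right i =>
      induction j using Fin.addCases with
      | left j =>
        simp only [B, Fin.addCases_left, Fin.addCases_right]
        exact hd.symm.mono Set.inter_subset_left Set.inter_subset_left
      | right j =>
        simp only [B, Fin.addCases_right]
        refine Set.disjoint_left.2 ?_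
        rintro s ⟨-, rfl⟩ ⟨-, hj⟩
        exact hij (congrArg _ hj)
  have hi := hX.indep_count _ B hB hBd
  have hle : ∀ i, MeasurableSpace.comap (fun ω => (X ω ∩ B i).encard) ⊤ ≤ mΩ := fun i =>
    measurable_iff_comap_le.1 (hX.measurable_count _ (hB i))
  have hST : Disjoint (Set.range (Fin.castAdd h.1 : Fin g.1 → _))
      (Set.range (Fin.natAdd g.1 : Fin h.1 → _)) := by
    refine Set.disjoint_left.2 ?_
    rintro _ ⟨i, rfl⟩ ⟨j, hj⟩
    have := congrArg Fin.val hj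
    simp at this
    omega
  have := indep_iSup_of_disjoint hle hi hST
  rw [iSup_range, iSup_range] at this
  simpa [B, labelAlgebra] using this

theorem IsPoissonPointProcess.indep_countsAlgebra [IsProbabilityMeasure P]
    (hX : IsPoissonPointProcess X m P) {R R' : Set S} (hR : MeasurableSet R)
    (hR' : MeasurableSet R') (hd : Disjoint R R') :
    Indep (countsAlgebra X R) (countsAlgebra X R') P := by
  have hle := countsAlgebra_le hX.measurableCounts hR
  have hle' := countsAlgebra_le hX.measurableCounts hR'
  rw [countsAlgebra_eq_iSup X R]
  refine indep_iSup_of_directed_le (fun g => ?_)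
    (fun g => (labelAlgebra_le_countsAlgebra X R g).trans hle) hle' (directed_labelAlgebra X R)
  rw [countsAlgebra_eq_iSup X R']
  refine Indep.symm (indep_iSup_of_directed_le (fun h => ?_)
    (fun h => (labelAlgebra_le_countsAlgebra X R' h).trans hle')
    ((labelAlgebra_le_countsAlgebra X R g).trans hle) (directed_labelAlgebra X R'))
  exact (hX.indep_labelAlgebra hR hR' hd g h).symm

theorem IsPoissonPointProcess.measure_encard_mem (hX : IsPoissonPointProcess X m P) {B : Set S}
    (hB : MeasurableSet B) (hm : m B ≠ ∞) (s : Set ℕ∞) :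
    P {ω | (X ω ∩ B).encard ∈ s} = poissonMeasure (m B).toNNReal {k : ℕ | (k : ℕ∞) ∈ s} := by
  have h := congrArg (fun μ => μ s) (hX.map_count B hB hm)
  rw [Measure.map_apply (hX.measurable_count B hB) .of_discrete,
    Measure.map_apply .of_discrete .of_discrete] at h
  exact h

theorem IsPoissonPointProcess.measure_empty (hX : IsPoissonPointProcess X m P) {B : Set S}
    (hB : MeasurableSet B) (hm : m B ≠ ∞) :
    P {ω | X ω ∩ B = ∅} = ENNReal.ofReal (Real.exp (-(m B).toReal)) := by
  have h := hX.measure_encard_mem hB hm {0}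
  simp [poissonMeasure_singleton] at h
  exact h

theorem IsPoissonPointProcess.measure_nonempty_le (hX : IsPoissonPointProcess X m P) {B : Set S}
    (hB : MeasurableSet B) : P {ω | (X ω ∩ B).Nonempty} ≤ m B := by
  by_cases hm : m B = ∞
  · simp [hm]
  have h := hX.measure_encard_mem hB hm {0}ᶜ
  have h2 : {k : ℕ | (k : ℕ∞) ∈ ({0}ᶜ : Set ℕ∞)} = {0}ᶜ := by ext; simp
  simp only [Set.mem_compl_iff, Set.mem_singleton_iff, Set.encard_eq_zero, ← ne_eq,
    ← Set.nonempty_iff_ne_empty] at h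
  rw [h]
  simp only [Set.mem_compl_iff, Set.mem_singleton_iff] at h2
  simp only [ne_eq, h2]
  rw [prob_compl_eq_one_sub (.of_discrete), poissonMeasure_singleton]
  have h3 := Real.add_one_le_exp (-(m B).toReal)
  simp only [pow_zero, mul_one, Nat.factorial_zero, Nat.cast_one, div_one]
  rw [← ENNReal.ofReal_one, ← ENNReal.ofReal_sub _ (Real.exp_pos _).le]
  refine ENNReal.ofReal_le_of_le_toReal ?_
  change 1 - Real.exp (-(m B).toReal) ≤ _
  linarith

/-- With `x` the mass, `1 - exp (-x) (1 + x) ≤ 1 - (1 - x) (1 + x) = x ^ 2`. The quadratic order is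
what makes ties negligible. -/
theorem IsPoissonPointProcess.measure_nontrivial_le (hX : IsPoissonPointProcess X m P) {B : Set S}
    (hB : MeasurableSet B) : P {ω | (X ω ∩ B).Nontrivial} ≤ m B ^ 2 := by
  by_cases hm : m B = ∞
  · simp [hm]
  have h := hX.measure_encard_mem hB hm (Set.Ioi 1)
  have h2 : {k : ℕ | 1 < (k : ℕ∞)} = {0, 1}ᶜ := by
    ext k
    simp only [Set.mem_ofPred_eq, Nat.one_lt_cast, Set.mem_compl_iff, Set.mem_insert_iff,
      Set.mem_singleton_iff]
    omega
  simp only [Set.mem_Ioi, Set.one_lt_encard_iff_nontrivial] at h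
  rw [h, h2, prob_compl_eq_one_sub (.of_discrete), Set.insert_eq,
    measure_union (by simp) .of_discrete, poissonMeasure_singleton, poissonMeasure_singleton]
  simp only [pow_zero, mul_one, Nat.factorial_zero, Nat.cast_one, div_one, pow_one,
    Nat.factorial_one]
  rw [← ENNReal.ofReal_add (by positivity) (by positivity), ← ENNReal.ofReal_one,
    ← ENNReal.ofReal_sub _ (by positivity)]
  refine ENNReal.ofReal_le_of_le_toReal ?_
  rw [ENNReal.toReal_pow]
  change 1 - (Real.exp (-(m B).toReal) + Real.exp (-(m B).toReal) * (m B).toReal) ≤ _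
  have h3 := Real.add_one_le_exp (-(m B).toReal)
  nlinarith [ENNReal.toReal_nonneg (a := m B)]

theorem IsPoissonPointProcess.ae_finite (hX : IsPoissonPointProcess X m P) {B : Set S}
    (hB : MeasurableSet B) (hm : m B ≠ ∞) : ∀ᵐ ω ∂P, (X ω ∩ B).Finite := by
  have h := hX.measure_encard_mem hB hm {⊤}
  rw [ae_iff]
  simpa using h

theorem IsPoissonPointProcess.ae_empty (hX : IsPoissonPointProcess X m P) {B : Set S}
    (hB : MeasurableSet B) (hm : m B = 0) : ∀ᵐ ω ∂P, X ω ∩ B = ∅ := by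
  rw [ae_iff]
  have := hX.measure_nonempty_le hB
  rw [hm, nonpos_iff_eq_zero] at this
  simpa [← Set.nonempty_iff_ne_empty, ← ne_eq] using this

end Independence

section Chains

/-! ### Long chains are unlikely -/

variable {d : ℕ}

/-- The grid cube `z` in the `j`-th time interval of length `2⁻ᵏ`. -/
def slabCell (k : ℕ) (z : Fin d → ℤ) (j : ℕ) : Set (SpaceTime d) :=
  {w | cell w.1 = z ∧ w.2 ∈ Set.Ico ((j : ℝ) / 2 ^ k) ((j + 1) / 2 ^ k)}

theorem measurableSet_slabCell (k : ℕ) (z : Fin d → ℤ) (j : ℕ) :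
    MeasurableSet (slabCell k z j) :=
  (measurable_cell.comp measurable_fst (measurableSet_singleton z)).inter
    (measurable_snd measurableSet_Ico)

theorem mem_slabCell (k : ℕ) (w : SpaceTime d) (hw : 0 ≤ w.2) :
    w ∈ slabCell k (cell w.1) ⌊2 ^ k * w.2⌋₊ := by
  refine ⟨rfl, ?_, ?_⟩
  · rw [div_le_iff₀ (by positivity), mul_comm]
    exact Nat.floor_le (by positivity)
  · rw [lt_div_iff₀ (by positivity), mul_comm]
    exact Nat.lt_floor_add_one _

/-- The grid cubes that are within reach of one step of a chain from the grid cube `z`. -/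
noncomputable def neighbours (z : Fin d → ℤ) : Finset (Fin d → ℤ) :=
  Fintype.piFinset fun i => Finset.Icc (z i - 2 * d) (z i + 2 * d)

theorem card_neighbours (z : Fin d → ℤ) : (neighbours z).card = (4 * d + 1) ^ d := by
  simp only [neighbours, Fintype.card_piFinset, Int.card_Icc]
  rw [Finset.prod_congr rfl (g := fun _ => 4 * d + 1) (fun i _ => by omega)]
  simp

theorem mem_neighbours {z z' : Fin d → ℤ} (h : dist z' z ≤ 2 * d) : z' ∈ neighbours z := by
  rw [neighbours, Fintype.mem_piFinset]
  intro i
  have h1 := (dist_le_pi_dist z' z i).trans h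
  rw [Int.dist_eq] at h1
  have h2 : |z' i - z i| ≤ 2 * d := by exact_mod_cast h1
  rw [abs_le] at h2
  rw [Finset.mem_Icc]
  omega

/-- A sequence of occupied neighbouring cubes with strictly decreasing time intervals. -/
def SlabChain (X : Set (SpaceTime d)) (k : ℕ) : ℕ → (Fin d → ℤ) → ℕ → Prop
  | 0, z, j => (X ∩ slabCell k z j).Nonempty
  | n + 1, z, j => (X ∩ slabCell k z j).Nonempty ∧
      ∃ z' ∈ neighbours z, ∃ j' ∈ Finset.range j, SlabChain X k n z' j'

/-- A chain has finitely many strict time gaps; once the slab length `2⁻ᵏ` is below all of them,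
successive balls lie in different slabs. -/
theorem HasChain.eventually_slabChain {X : Set (SpaceTime d)} (hX : ∀ v ∈ X, 0 ≤ v.2) {n : ℕ}
    {w : SpaceTime d} (h : HasChain X n w) :
    ∀ᶠ k in atTop, SlabChain X k n (cell w.1) ⌊2 ^ k * w.2⌋₊ := by
  induction n generalizing w with
  | zero => exact .of_forall fun k => ⟨w, h, mem_slabCell k w (hX w h)⟩
  | succ n ih =>
    obtain ⟨hw, v, hv, hlt, ho, hc⟩ := h
    have hlim : Tendsto (fun k : ℕ => (2 : ℝ) ^ k * (w.2 - v.2)) atTop atTop :=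
      (tendsto_pow_atTop_atTop_of_one_lt (by norm_num)).atTop_mul_const (by linarith)
    filter_upwards [ih hc, hlim.eventually_ge_atTop 1] with k hk hk1
    refine ⟨⟨w, hw, mem_slabCell k w (hX w hw)⟩, cell v.1, mem_neighbours (dist_cell_le ho),
      _, ?_, hk⟩
    rw [Finset.mem_range, Nat.lt_iff_add_one_le, ← Nat.floor_add_one (by have := hX v hv; positivity)]
    exact Nat.floor_mono (by linarith)

/-! ### Probability bounds for chains -/

section Measure

variable {Ω : Type*} [mΩ : MeasurableSpace Ω] {X : Ω → Set (SpaceTime d)}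
  {m : Measure (SpaceTime d)} {P : Measure Ω} [IsProbabilityMeasure P]

omit mΩ in
theorem measurableSet_nonempty_slabCell {R : Set (SpaceTime d)} {k : ℕ} {z : Fin d → ℤ} {j : ℕ}
    (h : slabCell k z j ⊆ R) :
    MeasurableSet[countsAlgebra X R] {ω | (X ω ∩ slabCell k z j).Nonempty} := by
  have := measurable_countsAlgebra X R (measurableSet_slabCell k z j)
    (MeasurableSet.of_discrete (s := {0}ᶜ))
  rw [Set.inter_eq_self_of_subset_right h] at this
  simpa [Set.preimage, ← ne_eq, ← Set.nonempty_iff_ne_empty] using this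

theorem measurableSet_snd_lt (a : ℝ) : MeasurableSet {w : SpaceTime d | w.2 < a} :=
  measurable_snd measurableSet_Iio

omit mΩ in
theorem measurableSet_slabChain (k n : ℕ) (z : Fin d → ℤ) (j : ℕ) :
    MeasurableSet[countsAlgebra X {w | w.2 < ((j : ℝ) + 1) / 2 ^ k}]
      {ω | SlabChain (X ω) k n z j} := by
  have h0 : slabCell k z j ⊆ {w | w.2 < ((j : ℝ) + 1) / 2 ^ k} := fun w hw => hw.2.2
  induction n generalizing z j with
  | zero => exact measurableSet_nonempty_slabCell h0
  | succ n ih =>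
    have h1 : MeasurableSet[countsAlgebra X {w | w.2 < ((j : ℝ) + 1) / 2 ^ k}]
        {ω | ∃ z' ∈ neighbours z, ∃ j' ∈ Finset.range j, SlabChain (X ω) k n z' j'} := by
      have : {ω | ∃ z' ∈ neighbours z, ∃ j' ∈ Finset.range j, SlabChain (X ω) k n z' j'} =
          ⋃ z' ∈ neighbours z, ⋃ j' ∈ Finset.range j, {ω | SlabChain (X ω) k n z' j'} := by
        ext ω; simp
      rw [this]
      refine Finset.measurableSet_biUnion _ fun z' _ => Finset.measurableSet_biUnion _ fun j' hj' => ?_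
      refine countsAlgebra_mono X (measurableSet_snd_lt _) ?_ _ (ih z' j' fun w hw => hw.2.2)
      intro w (hw : w.2 < _)
      refine lt_of_lt_of_le hw ?_
      have : (j' : ℝ) ≤ j := by exact_mod_cast (Finset.mem_range.1 hj').le
      gcongr
    exact (measurableSet_nonempty_slabCell h0).inter h1

theorem sum_range_choose_eq (n j : ℕ) : ∑ i ∈ Finset.range j, i.choose n = j.choose (n + 1) := by
  induction j with
  | zero => simp
  | succ j ih => rw [Finset.sum_range_succ, ih, Nat.choose_succ_succ, add_comm]

/-- The top slab is independent of everything strictly earlier, so each step costs one factor `2⁻ᵏ`.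
The other factors count the choices of neighbouring cubes and, by the hockey-stick identity, the
decreasing sequences of slabs. -/
theorem IsPoissonPointProcess.measure_slabChain_le (hX : IsPoissonPointProcess X m P)
    (hm : ∀ k (z : Fin d → ℤ) j, m (slabCell k z j) ≤ (2⁻¹ : ℝ≥0∞) ^ k) (k n : ℕ)
    (z : Fin d → ℤ) (j : ℕ) :
    P {ω | SlabChain (X ω) k n z j} ≤
      (((4 * d + 1) ^ d) ^ n * j.choose n : ℕ) * ((2⁻¹ : ℝ≥0∞) ^ k) ^ (n + 1) := by
  induction n generalizing z j with
  | zero =>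
    simpa [SlabChain] using (hX.measure_nonempty_le (measurableSet_slabCell k z j)).trans (hm k z j)
  | succ n ih =>
    have hR := measurableSet_slabCell k z j
    have hR' := measurableSet_snd_lt (d := d) ((j : ℝ) / 2 ^ k)
    have hdisj : Disjoint (slabCell k z j) {w | w.2 < (j : ℝ) / 2 ^ k} :=
      Set.disjoint_left.2 fun w hw hw' => absurd hw.2.1 (not_le.2 hw')
    have hind := hX.indep_countsAlgebra hR hR' hdisj
    have hset : {ω | ∃ z' ∈ neighbours z, ∃ j' ∈ Finset.range j, SlabChain (X ω) k n z' j'} =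
        ⋃ z' ∈ neighbours z, ⋃ j' ∈ Finset.range j, {ω | SlabChain (X ω) k n z' j'} := by
      ext ω; simp
    have h1 : MeasurableSet[countsAlgebra X {w | w.2 < (j : ℝ) / 2 ^ k}]
        {ω | ∃ z' ∈ neighbours z, ∃ j' ∈ Finset.range j, SlabChain (X ω) k n z' j'} := by
      rw [hset]
      refine Finset.measurableSet_biUnion _ fun z' _ => Finset.measurableSet_biUnion _ fun j' hj' => ?_
      refine countsAlgebra_mono X (measurableSet_snd_lt _) ?_ _ (measurableSet_slabChain k n z' j')
      intro w (hw : w.2 < _)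
      refine lt_of_lt_of_le hw ?_
      have : (j' : ℝ) + 1 ≤ j := by exact_mod_cast Finset.mem_range.1 hj'
      gcongr
    have h2 : {ω | SlabChain (X ω) k (n + 1) z j} = {ω | (X ω ∩ slabCell k z j).Nonempty} ∩
        {ω | ∃ z' ∈ neighbours z, ∃ j' ∈ Finset.range j, SlabChain (X ω) k n z' j'} := rfl
    rw [h2, (Indep_iff _ _ P).1 hind _ _ (measurableSet_nonempty_slabCell subset_rfl) h1]
    calc _ ≤ (2⁻¹ : ℝ≥0∞) ^ k * ∑ z' ∈ neighbours z, ∑ j' ∈ Finset.range j,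
          ((((4 * d + 1) ^ d) ^ n * j'.choose n : ℕ) * ((2⁻¹ : ℝ≥0∞) ^ k) ^ (n + 1)) := by
          gcongr
          · exact (hX.measure_nonempty_le hR).trans (hm k z j)
          · rw [hset]
            refine (measure_biUnion_finset_le _ _).trans (Finset.sum_le_sum fun z' _ => ?_)
            exact (measure_biUnion_finset_le _ _).trans (Finset.sum_le_sum fun j' _ => ih z' j')
      _ = _ := by
          simp only [← Finset.sum_mul, ← Nat.cast_sum, ← Finset.mul_sum, sum_range_choose_eq,
            Finset.sum_const, card_neighbours, nsmul_eq_mul]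
          push_cast
          ring

/-- Summing over the top slab gives `N.choose (n + 1)` with `N ≤ 2 ^ k (s + 1)`, and `N.choose (n +
1) ≤ N ^ (n + 1) / (n + 1)!` cancels the powers of `2⁻ᵏ`. The bound is uniform in `k` and passes to
the limit of fine slabs. -/
theorem IsPoissonPointProcess.measure_hasChain_le (hX : IsPoissonPointProcess X m P)
    (hm : ∀ k (z : Fin d → ℤ) j, m (slabCell k z j) ≤ (2⁻¹ : ℝ≥0∞) ^ k)
    (hpos : ∀ᵐ ω ∂P, ∀ v ∈ X ω, 0 ≤ v.2) (n : ℕ) (z : Fin d → ℤ) {s : ℝ} (hs : 0 ≤ s + 1) :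
    P {ω | ∃ w ∈ X ω, cell w.1 = z ∧ w.2 ≤ s ∧ HasChain (X ω) n w} ≤
      ENNReal.ofReal (((4 * d + 1) ^ d) ^ n * (s + 1) ^ (n + 1) / (n + 1).factorial) := by
  set b := ENNReal.ofReal (((4 * d + 1) ^ d) ^ n * (s + 1) ^ (n + 1) / (n + 1).factorial)
  -- Using `s + 1` instead of `s` leaves room for the rounded-down slab index of a ball arriving at
  -- time `s`.
  let F : ℕ → Set Ω := fun k => ⋃ j ∈ Finset.range ⌊2 ^ k * (s + 1)⌋₊, {ω | SlabChain (X ω) k n z j}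
  have hF : ∀ k, P (F k) ≤ b := by
    intro k
    calc P (F k) ≤ ∑ j ∈ Finset.range ⌊2 ^ k * (s + 1)⌋₊,
          ((((4 * d + 1) ^ d) ^ n * j.choose n : ℕ) * ((2⁻¹ : ℝ≥0∞) ^ k) ^ (n + 1)) :=
          (measure_biUnion_finset_le _ _).trans
            (Finset.sum_le_sum fun j _ => hX.measure_slabChain_le hm k n z j)
      _ = (((4 * d + 1) ^ d) ^ n * (⌊2 ^ k * (s + 1)⌋₊.choose (n + 1)) : ℕ) *
          ((2⁻¹ : ℝ≥0∞) ^ k) ^ (n + 1) := by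
          rw [← Finset.sum_mul, ← Nat.cast_sum, ← Finset.mul_sum, sum_range_choose_eq]
      _ = ENNReal.ofReal ((((4 * d + 1) ^ d) ^ n * (⌊2 ^ k * (s + 1)⌋₊.choose (n + 1))) *
          ((2⁻¹ : ℝ) ^ k) ^ (n + 1)) := by
          rw [ENNReal.ofReal_mul (by positivity), ← ENNReal.ofReal_natCast]
          congr 1
          · push_cast; rfl
          · rw [ENNReal.ofReal_pow (by positivity), ENNReal.ofReal_pow (by positivity),
              ENNReal.ofReal_inv_of_pos (by norm_num)]
            norm_num
      _ ≤ b := by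
          refine ENNReal.ofReal_le_ofReal ?_
          rw [mul_assoc, mul_div_assoc]
          gcongr
          calc ((⌊2 ^ k * (s + 1)⌋₊.choose (n + 1) : ℕ) : ℝ) * ((2⁻¹ : ℝ) ^ k) ^ (n + 1)
              ≤ ((2 ^ k * (s + 1)) ^ (n + 1) / (n + 1).factorial) * ((2⁻¹ : ℝ) ^ k) ^ (n + 1) := by
                gcongr
                refine (Nat.choose_le_pow_div _ _).trans ?_
                gcongr
                exact Nat.floor_le (by positivity)
            _ = _ := by
                rw [inv_pow, mul_pow, inv_pow]
                field_simp
  -- The chain event lies in the limit inferior of the `F k`, an increasing union of sets each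
  -- contained in some `F k`.
  have hsub : {ω | ∃ w ∈ X ω, cell w.1 = z ∧ w.2 ≤ s ∧ HasChain (X ω) n w} ≤ᵐ[P]
      ⋃ k, ⋂ k' ∈ Set.Ici k, F k' := by
    filter_upwards [hpos] with ω hω
    rintro ⟨w, hw, hz, hws, hc⟩
    obtain ⟨k, hk⟩ := eventually_atTop.1 (hc.eventually_slabChain hω)
    refine Set.mem_iUnion.2 ⟨k, Set.mem_iInter₂.2 fun k' hk' => ?_⟩
    refine Set.mem_iUnion₂.2 ⟨_, ?_, hz ▸ hk k' hk'⟩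
    have h0 := hω w hw
    have h1 : (1 : ℝ) ≤ 2 ^ k' := one_le_pow₀ (by norm_num)
    rw [Finset.mem_range, Nat.lt_iff_add_one_le, ← Nat.floor_add_one (by positivity)]
    exact Nat.floor_mono (by nlinarith)
  refine (measure_mono_ae hsub).trans ?_
  rw [Monotone.measure_iUnion]
  · exact iSup_le fun k => (measure_mono (Set.iInter₂_subset k Set.self_mem_Ici)).trans (hF k)
  · intro k l hkl
    exact Set.biInter_subset_biInter_left (Set.Ici_subset_Ici.2 hkl)

/-- From `x ^ k / k! ≤ exp x` with `x = k = n + 1`: for `c = 1 / (M e ^ 2)` the bound is at most `(M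
c) ^ (n + 1) * exp (n + 1)`, and `M c = exp (-2)`. -/
theorem exists_pos_forall_chain_bound_le {M : ℝ} (hM : 1 ≤ M) :
    ∃ c : ℝ, 0 < c ∧ ∀ n : ℕ,
      M ^ n * (c * (n + 1)) ^ (n + 1) / (n + 1).factorial ≤ Real.exp (-(n + 1)) := by
  refine ⟨1 / (M * Real.exp 2), by positivity, fun n => ?_⟩
  have h1 := Real.pow_div_factorial_le_exp ((n : ℝ) + 1) (by positivity) (n + 1)
  calc M ^ n * (1 / (M * Real.exp 2) * (n + 1)) ^ (n + 1) / (n + 1).factorial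
      = M ^ n * (1 / (M * Real.exp 2)) ^ (n + 1) * (((n : ℝ) + 1) ^ (n + 1) / (n + 1).factorial) := by
        rw [mul_pow]; ring
    _ ≤ M ^ (n + 1) * (1 / (M * Real.exp 2)) ^ (n + 1) * Real.exp (n + 1) := by
        gcongr
        omega
    _ = Real.exp (-(n + 1)) := by
        rw [← mul_pow, show M * (1 / (M * Real.exp 2)) = Real.exp (-2) by
          rw [Real.exp_neg]; field_simp, ← Real.exp_nat_mul, ← Real.exp_add]
        congr 1
        push_cast
        ring

end Measure

end Chains

section BoundaryCells

/-! ### Grid cubes at the boundary -/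

variable {d : ℕ}

theorem abs_cell_sub_cell_le (x y : EuclideanSpace ℝ (Fin d)) (i : Fin d) :
    |((cell x i - cell y i : ℤ) : ℝ)| ≤ d * dist x y + 1 := by
  have h1 : |x i - y i| ≤ dist x y := by
    have := PiLp.norm_apply_le (x - y) i
    rw [dist_eq_norm]
    simpa using this
  have h2 : |(d : ℝ) * x i - d * y i| ≤ d * dist x y := by
    rw [← mul_sub, abs_mul, abs_of_nonneg (by positivity)]; gcongr
  have a1 := Int.floor_le ((d : ℝ) * x i)
  have a2 := Int.lt_floor_add_one ((d : ℝ) * x i)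
  have b1 := Int.floor_le ((d : ℝ) * y i)
  have b2 := Int.lt_floor_add_one ((d : ℝ) * y i)
  rw [abs_le] at h2 ⊢
  simp only [cell]
  push_cast
  constructor <;> linarith

theorem dist_le_of_floor_eq {p : ℕ} {t : ℝ} (ht : 0 < t) {u v : EuclideanSpace ℝ (Fin p)}
    (h : ∀ i, ⌊t * u i⌋ = ⌊t * v i⌋) : dist u v ≤ p / t := by
  rw [EuclideanSpace.dist_eq]
  refine Real.sqrt_le_iff.2 ⟨by positivity, ?_⟩
  have h1 : ∀ i, dist (u i) (v i) ^ 2 ≤ (1 / t) ^ 2 := by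
    intro i
    have h2 := Int.abs_sub_lt_one_of_floor_eq_floor (h i)
    rw [← mul_sub, abs_mul, abs_of_pos ht] at h2
    rw [Real.dist_eq]
    refine pow_le_pow_left₀ (abs_nonneg _) ?_ 2
    rw [le_div_iff₀ ht]
    linarith
  calc ∑ i, dist (u i) (v i) ^ 2 ≤ ∑ _i : Fin p, (1 / t) ^ 2 := Finset.sum_le_sum fun i _ => h1 i
    _ = p * (1 / t) ^ 2 := by simp
    _ ≤ (p : ℝ) ^ 2 * (1 / t) ^ 2 := by
        gcongr
        exact_mod_cast Nat.le_self_pow two_ne_zero p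
    _ = (p / t) ^ 2 := by ring

/-- Parameter cubes of side `1 / (r + 1)` number `O((r + 1) ^ p)` on a bounded set, and `r • f` maps
the part of `K` in each to a set of diameter at most `L * p`, which meets boundedly many grid cubes.
Scaling by `r + 1` rather than `r` keeps this valid for small `r`. -/
theorem exists_cells_of_lipschitzOnWith {p : ℕ} {K : Set (EuclideanSpace ℝ (Fin p))}
    (hK : Bornology.IsBounded K) {f : EuclideanSpace ℝ (Fin p) → EuclideanSpace ℝ (Fin d)}
    {L : ℝ≥0} (hf : LipschitzOnWith L f K) :
    ∃ C : ℝ, ∀ r : ℝ, 0 < r → ∃ Z : Finset (Fin d → ℤ),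
      (Z.card : ℝ) ≤ C * (r + 1) ^ p ∧ ∀ u ∈ K, cell (r • f u) ∈ Z := by
  classical
  obtain ⟨R, hR⟩ := hK.exists_norm_le
  obtain ⟨R', hR'⟩ := exists_nat_ge R
  obtain ⟨D, hD⟩ := exists_nat_ge ((d : ℝ) * (L * p) + 1)
  refine ⟨(2 * D + 1) ^ d * (2 * R' + 3) ^ p, fun r hr => ?_⟩
  let q : EuclideanSpace ℝ (Fin p) → Fin p → ℤ := fun u i => ⌊(r + 1) * u i⌋
  let N : ℕ := ⌈(R' : ℝ) * (r + 1)⌉₊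
  let G : Finset (Fin p → ℤ) := Fintype.piFinset fun _ => Finset.Icc (-(N : ℤ)) N
  have hG : ∀ u ∈ K, q u ∈ G := by
    intro u hu
    rw [Fintype.mem_piFinset]
    intro i
    have h1 : |u i| ≤ R' := (PiLp.norm_apply_le u i).trans ((hR u hu).trans hR')
    have h2 : |(r + 1) * u i| ≤ N := by
      rw [abs_mul, abs_of_pos (by linarith), mul_comm]
      exact (mul_le_mul_of_nonneg_right h1 (by linarith)).trans (Nat.le_ceil _)
    rw [abs_le] at h2
    rw [Finset.mem_Icc]
    refine ⟨Int.le_floor.2 (by push_cast; exact h2.1), ?_⟩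
    have := (Int.floor_le ((r + 1) * u i)).trans h2.2
    exact_mod_cast this
  -- Parameter cubes that miss `K` get the value `0`; they only add superfluous boxes to the cover.
  let rep : (Fin p → ℤ) → EuclideanSpace ℝ (Fin p) := fun γ =>
    if h : ∃ u ∈ K, q u = γ then h.choose else 0
  have hrep : ∀ u ∈ K, rep (q u) ∈ K ∧ q (rep (q u)) = q u := by
    intro u hu
    have h : ∃ v ∈ K, q v = q u := ⟨u, hu, rfl⟩
    simp only [rep, dif_pos h]
    exact h.choose_spec
  let box : (Fin d → ℤ) → Finset (Fin d → ℤ) := fun z =>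
    Fintype.piFinset fun i => Finset.Icc (z i - D) (z i + D)
  refine ⟨G.biUnion fun γ => box (cell (r • f (rep γ))), ?_, fun u hu => ?_⟩
  · have hbox : ∀ z, (box z).card = (2 * D + 1) ^ d := by
      intro z
      simp only [box, Fintype.card_piFinset, Int.card_Icc]
      rw [Finset.prod_congr rfl (g := fun _ => 2 * D + 1) (fun i _ => by omega)]
      simp
    have hGc : G.card = (2 * N + 1) ^ p := by
      simp only [G, Fintype.card_piFinset, Int.card_Icc]
      rw [Finset.prod_congr rfl (g := fun _ => 2 * N + 1) (fun i _ => by omega)]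
      simp
    have h1 := Finset.card_biUnion_le_card_mul G (fun γ => box (cell (r • f (rep γ)))) _
      fun γ _ => (hbox _).le
    rw [hGc] at h1
    have hN : (N : ℝ) ≤ R' * (r + 1) + 1 := (Nat.ceil_lt_add_one (by positivity)).le
    calc ((G.biUnion fun γ => box (cell (r • f (rep γ)))).card : ℝ)
        ≤ ((2 * N + 1) ^ p * (2 * D + 1) ^ d : ℕ) := by exact_mod_cast h1
      _ = (2 * D + 1) ^ d * (2 * N + 1) ^ p := by push_cast; ring
      _ ≤ (2 * D + 1) ^ d * ((2 * R' + 3) * (r + 1)) ^ p := by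
          gcongr
          nlinarith
      _ = _ := by rw [mul_pow]; ring
  · rw [Finset.mem_biUnion]
    refine ⟨q u, hG u hu, ?_⟩
    rw [Fintype.mem_piFinset]
    intro i
    obtain ⟨h1, h2⟩ := hrep u hu
    have h3 : dist (r • f u) (r • f (rep (q u))) ≤ L * p := by
      rw [dist_smul₀, Real.norm_of_nonneg hr.le]
      have h4 := hf.dist_le_mul u hu _ h1
      have h5 := dist_le_of_floor_eq (by linarith : 0 < r + 1) (fun i => congrFun h2.symm i)
      calc r * dist (f u) (f (rep (q u))) ≤ r * (L * (p / (r + 1))) := by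
            gcongr; exact h4.trans (by gcongr)
        _ = (L * p) * (r / (r + 1)) := by ring
        _ ≤ (L * p) * 1 := by
            gcongr
            rw [div_le_one (by linarith)]
            linarith
        _ = _ := mul_one _
    have h6 := abs_cell_sub_cell_le (r • f u) (r • f (rep (q u))) i
    have h7 : |((cell (r • f u) i - cell (r • f (rep (q u))) i : ℤ) : ℝ)| ≤ D := by
      refine h6.trans (le_trans ?_ hD)
      gcongr
    have h8 : |cell (r • f u) i - cell (r • f (rep (q u))) i| ≤ D := by exact_mod_cast h7
    rw [abs_le] at h8
    rw [Finset.mem_Icc]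
    omega

theorem exists_lipschitzOnWith_of_isCompact {p : ℕ} {K U : Set (EuclideanSpace ℝ (Fin p))}
    {f : EuclideanSpace ℝ (Fin p) → EuclideanSpace ℝ (Fin d)} (hK : IsCompact K) (hU : IsOpen U)
    (hKU : K ⊆ U) (hf : ContDiffOn ℝ 1 f U) : ∃ L, LipschitzOnWith L f K := by
  refine LocallyLipschitzOn.exists_lipschitzOnWith_of_compact hK fun x hx => ?_
  obtain ⟨L, t, ht, hL⟩ :=
    (hf.contDiffAt (hU.mem_nhds (hKU hx))).exists_lipschitzOnWith
  exact ⟨L, t, mem_nhdsWithin_of_mem_nhds ht, hL⟩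

theorem HasPiecewiseSmoothBoundary.exists_cells {A : Set (EuclideanSpace ℝ (Fin d))}
    (hA : HasPiecewiseSmoothBoundary A) :
    ∃ C : ℝ, ∀ r : ℝ, 0 < r → ∃ Z : Finset (Fin d → ℤ),
      (Z.card : ℝ) ≤ C * (r + 1) ^ (d - 1) ∧ ∀ x ∈ frontier (r • A), cell x ∈ Z := by
  classical
  obtain ⟨n, K, f, hf, hfr⟩ := hA
  have h : ∀ i, ∃ C : ℝ, ∀ r : ℝ, 0 < r → ∃ Z : Finset (Fin d → ℤ),
      (Z.card : ℝ) ≤ C * (r + 1) ^ (d - 1) ∧ ∀ u ∈ K i, cell (r • f i u) ∈ Z := by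
    intro i
    obtain ⟨hK, U, hU, hKU, hfU⟩ := hf i
    obtain ⟨L, hL⟩ := exists_lipschitzOnWith_of_isCompact hK hU hKU hfU
    exact exists_cells_of_lipschitzOnWith hK.isBounded hL
  choose C hC using h
  refine ⟨∑ i, C i, fun r hr => ?_⟩
  choose Z hZ hZK using fun i => hC i r hr
  refine ⟨Finset.univ.biUnion Z, ?_, fun x hx => ?_⟩
  · calc ((Finset.univ.biUnion Z).card : ℝ) ≤ ((∑ i, (Z i).card : ℕ) : ℝ) := by
          exact_mod_cast Finset.card_biUnion_le
      _ ≤ ∑ i, C i * (r + 1) ^ (d - 1) := by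
          push_cast
          exact Finset.sum_le_sum fun i _ => hZ i
      _ = _ := by rw [Finset.sum_mul]
  · have h1 : frontier (r • A) = r • frontier A :=
      ((Homeomorph.smulOfNeZero r hr.ne').image_frontier A).symm
    rw [h1, hfr] at hx
    obtain ⟨y, hy, rfl⟩ := hx
    obtain ⟨i, u, hu, rfl⟩ := Set.mem_iUnion.1 hy
    exact Finset.mem_biUnion.2 ⟨i, Finset.mem_univ i, hZK i u hu⟩

/-- The pieces have Hausdorff dimension at most `d - 1 < d`. The set `A` need not be measurable, and
in the continuum this null boundary allows its replacement by the interior. -/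
theorem HasPiecewiseSmoothBoundary.volume_frontier {A : Set (EuclideanSpace ℝ (Fin d))}
    (hd : 1 ≤ d) (hA : HasPiecewiseSmoothBoundary A) : volume (frontier A) = 0 := by
  obtain ⟨n, K, f, hf, hfr⟩ := hA
  rw [hfr, measure_iUnion_null_iff]
  intro i
  obtain ⟨hK, U, hU, hKU, hfU⟩ := hf i
  obtain ⟨L, hL⟩ := exists_lipschitzOnWith_of_isCompact hK hU hKU hfU
  have h1 : dimH (f i '' K i) < d := by
    refine (hL.dimH_image_le.trans (dimH_mono (Set.subset_univ _))).trans_lt ?_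
    rw [Real.dimH_univ_eq_finrank, finrank_euclideanSpace_fin]
    exact_mod_cast (by omega : d - 1 < d)
  have h2 : Measure.hausdorffMeasure (d : ℝ) (f i '' K i) = 0 := by
    have := hausdorffMeasure_of_dimH_lt (d := (d : ℝ≥0)) (by simpa using h1)
    simpa using this
  have h3 : (Measure.hausdorffMeasure (Module.finrank ℝ (EuclideanSpace ℝ (Fin d)) : ℝ) :
      Measure (EuclideanSpace ℝ (Fin d))).IsAddHaarMeasure := inferInstance
  rw [finrank_euclideanSpace_fin] at h3
  exact Measure.absolutelyContinuous_isAddHaarMeasure volume (Measure.hausdorffMeasure (d : ℝ)) h2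

theorem convex_nearby (n : ℕ) (z : Fin d → ℤ) : Convex ℝ (nearby n z) := by
  have h : nearby n z = {x | ∀ i, (z i : ℝ) - 2 * d * n ≤ d * x i ∧
      (d * x i : ℝ) < z i + 2 * d * n + 1} := by
    ext x
    change dist (cell x) z ≤ 2 * d * n ↔ _
    rw [dist_pi_le_iff (by positivity)]
    refine forall_congr' fun i => ?_
    have : dist (cell x i) (z i) ≤ 2 * d * n ↔ |cell x i - z i| ≤ 2 * d * n := by
      rw [Int.dist_eq]
      exact_mod_cast Iff.rfl
    rw [this, abs_le]
    have h1 : (z i : ℝ) - 2 * d * n ≤ d * x i ↔ z i - 2 * d * n ≤ cell x i := by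
      rw [cell, Int.le_floor]
      push_cast
      rfl
    have h2 : (d * x i : ℝ) < z i + 2 * d * n + 1 ↔ cell x i < z i + 2 * d * n + 1 := by
      rw [cell, Int.floor_lt]
      push_cast
      rfl
    rw [h1, h2]
    generalize (2 * d * n : ℤ) = q
    omega
  rw [h]
  intro x hx y hy a b ha hb hab i
  have hx' := hx i
  have hy' := hy i
  simp only [PiLp.add_apply, PiLp.smul_apply, smul_eq_mul]
  have e1 : (d : ℝ) * (a * x i + b * y i) = a * (d * x i) + b * (d * y i) := by ring
  rw [e1]
  have e2 : ∀ c : ℝ, c = a * c + b * c := fun c => by rw [← add_mul, hab, one_mul]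
  constructor
  · rw [e2 ((z i : ℝ) - 2 * d * n)]
    exact add_le_add (mul_le_mul_of_nonneg_left hx'.1 ha) (mul_le_mul_of_nonneg_left hy'.1 hb)
  · rw [e2 ((z i : ℝ) + 2 * d * n + 1)]
    rcases ha.eq_or_lt with rfl | ha'
    · have : b = 1 := by linarith
      subst this
      linarith [hy'.2]
    · exact add_lt_add_of_lt_of_le (mul_lt_mul_of_pos_left hx'.2 ha')
        (mul_le_mul_of_nonneg_left hy'.2.le hb)

/-- A connected set that avoids the frontier lies in the interior of `A` or in that of its
complement, and `x` decides which. -/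
theorem nearby_subset_of_forall_frontier {A : Set (EuclideanSpace ℝ (Fin d))} {n : ℕ}
    {z : Fin d → ℤ} {Z : Finset (Fin d → ℤ)} (hZ : ∀ x ∈ frontier A, cell x ∈ Z)
    (hfar : ∀ y ∈ Z, 2 * d * n < dist y z) {x : EuclideanSpace ℝ (Fin d)} (hx : x ∈ A)
    (hxz : cell x = z) : nearby n z ⊆ A := by
  have hdisj : ∀ y ∈ nearby n z, y ∉ frontier A := fun y hy hyA =>
    absurd (show dist (cell y) z ≤ 2 * d * n from hy) (not_le.2 (hfar _ (hZ y hyA)))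
  have hxn : x ∈ nearby n z := by
    change dist (cell x) z ≤ _
    rw [hxz, dist_self]
    positivity
  have hcompl : (frontier A)ᶜ = interior A ∪ interior Aᶜ := compl_frontier_eq_union_interior
  have hsub : nearby n z ⊆ interior A ∪ interior Aᶜ := fun y hy => hcompl ▸ hdisj y hy
  have hxi : x ∈ interior A := by
    rcases hsub hxn with h | h
    · exact h
    · exact absurd hx (interior_subset h)
  refine ((convex_nearby n z).isPreconnected.subset_left_of_subset_union isOpen_interior
    isOpen_interior ?_ hsub ⟨x, hxn, hxi⟩).trans interior_subset
  exact Set.disjoint_of_subset interior_subset interior_subset disjoint_compl_right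

end BoundaryCells

section Inputs

/-! ### The two inputs -/

variable {d : ℕ} {Ω : Type*} [mΩ : MeasurableSpace Ω] {P : Measure Ω}

/-- The common properties of the continuum and the lattice input from which the moment bounds are
derived. -/
structure IsRegularInput (X : Ω → Set (SpaceTime d)) (m : Measure (SpaceTime d))
    (P : Measure Ω) : Prop where
  poisson : IsPoissonPointProcess X m P
  slab_le : ∀ k (z : Fin d → ℤ) j, m (slabCell k z j) ≤ (2⁻¹ : ℝ≥0∞) ^ k
  finite : ∀ (z : Fin d → ℤ) k, m (cellUpTo z k) ≠ ∞
  nonneg : ∀ᵐ ω ∂P, ∀ v ∈ X ω, 0 ≤ v.2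
  late : ∃ D : ℝ, 0 ≤ D ∧ ∀ (z : Fin d → ℤ) (s : ℝ), ∃ L : Set Ω,
    P L ≤ ENNReal.ofReal (D * Real.exp (-s)) ∧ ∀ᵐ ω ∂P, ω ∉ L →
      ∀ R w, Fate (restrictInput (X ω) R) w true → cell w.1 = z → w.2 ≤ s
  unique : ∀ᵐ ω ∂P, ∀ R w v, Fate (restrictInput (X ω) R) w true →
    Fate (restrictInput (X ω) R) v true → cell w.1 = cell v.1 → w = v
  exists_measurable : ∀ A : Set (EuclideanSpace ℝ (Fin d)), volume (frontier A) = 0 →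
    ∃ A', MeasurableSet A' ∧ ∀ᵐ ω ∂P, restrictInput (X ω) A = restrictInput (X ω) A'

section Product

variable {μ : Measure (EuclideanSpace ℝ (Fin d))} {T : Set ℝ}

theorem slabCell_eq_prod (k : ℕ) (z : Fin d → ℤ) (j : ℕ) :
    slabCell k z j = (cell ⁻¹' {z}) ×ˢ Set.Ico ((j : ℝ) / 2 ^ k) ((j + 1) / 2 ^ k) := rfl

theorem prod_slabCell_le (hμ : ∀ z, μ (cell ⁻¹' {z}) ≤ 1) (k : ℕ) (z : Fin d → ℤ) (j : ℕ) :
    μ.prod (volume.restrict T) (slabCell k z j) ≤ (2⁻¹ : ℝ≥0∞) ^ k := by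
  rw [slabCell_eq_prod, Measure.prod_prod]
  calc _ ≤ 1 * volume (Set.Ico ((j : ℝ) / 2 ^ k) ((j + 1) / 2 ^ k)) := by
        gcongr
        · exact hμ z
        · exact Measure.restrict_le_self
    _ = _ := by
        rw [one_mul, Real.volume_Ico, ← sub_div, add_sub_cancel_left, one_div,
          ENNReal.ofReal_inv_of_pos (by positivity), ENNReal.ofReal_pow (by norm_num),
          ENNReal.inv_pow]
        norm_num

theorem prod_cellUpTo_ne_top (hμ : ∀ z, μ (cell ⁻¹' {z}) ≤ 1) (hT : T ⊆ Set.Ici 0)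
    (z : Fin d → ℤ) (k : ℕ) : μ.prod (volume.restrict T) (cellUpTo z k) ≠ ∞ := by
  change μ.prod (volume.restrict T) ((cell ⁻¹' {z}) ×ˢ Set.Iic (k : ℝ)) ≠ ∞
  rw [Measure.prod_prod, Measure.restrict_apply measurableSet_Iic]
  refine ENNReal.mul_ne_top ((hμ z).trans_lt ENNReal.one_lt_top).ne ?_
  refine ne_top_of_le_ne_top (b := volume (Set.Icc (0 : ℝ) k)) (by simp) (measure_mono ?_)
  exact fun t ht => ⟨hT ht.2, ht.1⟩

theorem IsPoissonPointProcess.ae_fst_notMem {X : Ω → Set (SpaceTime d)}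
    (hX : IsPoissonPointProcess X (μ.prod (volume.restrict T)) P)
    {B : Set (EuclideanSpace ℝ (Fin d))} (hB : MeasurableSet B) (h0 : μ B = 0) :
    ∀ᵐ ω ∂P, ∀ v ∈ X ω, v.1 ∉ B := by
  have h := hX.ae_empty (B := B ×ˢ Set.univ) (hB.prod .univ) (by rw [Measure.prod_prod, h0, zero_mul])
  filter_upwards [h] with ω hω v hv hvB
  exact Set.eq_empty_iff_forall_notMem.1 hω v ⟨hv, hvB, trivial⟩

theorem IsPoissonPointProcess.ae_snd_mem {X : Ω → Set (SpaceTime d)} (hT : MeasurableSet T)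
    (hX : IsPoissonPointProcess X (μ.prod (volume.restrict T)) P) :
    ∀ᵐ ω ∂P, ∀ v ∈ X ω, v.2 ∈ T := by
  have h := hX.ae_empty (B := Set.univ ×ˢ Tᶜ) (MeasurableSet.univ.prod hT.compl)
    (by rw [Measure.prod_prod, Measure.restrict_apply hT.compl]; simp)
  filter_upwards [h] with ω hω v hv
  by_contra hvT
  exact Set.eq_empty_iff_forall_notMem.1 hω v ⟨hv, trivial, hvT⟩

end Product

theorem measurableSet_cell_preimage (z : Fin d → ℤ) : MeasurableSet (cell ⁻¹' {z}) :=
  measurable_cell (measurableSet_singleton z)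

theorem volume_cell_preimage_le (hd : 1 ≤ d) (z : Fin d → ℤ) : volume (cell ⁻¹' {z}) ≤ 1 := by
  have hd' : (1 : ℝ) ≤ d := by exact_mod_cast hd
  have h : cell ⁻¹' {z} = WithLp.ofLp ⁻¹' (Set.univ.pi fun i : Fin d =>
      Set.Ico ((z i : ℝ) / d) ((z i + 1) / d)) := by
    ext x
    simp only [Set.mem_preimage, Set.mem_singleton_iff, funext_iff, cell, Int.floor_eq_iff,
      Set.mem_pi, Set.mem_univ, true_imp_iff, Set.mem_Ico]
    refine forall_congr' fun i => ?_
    rw [div_le_iff₀ (by linarith), lt_div_iff₀ (by linarith), mul_comm]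
  rw [h, (PiLp.volume_preserving_ofLp (Fin d)).measure_preimage
    (MeasurableSet.univ_pi fun i => measurableSet_Ico).nullMeasurableSet, Real.volume_pi_Ico]
  refine Finset.prod_le_one' fun i _ => ?_
  rw [← ENNReal.ofReal_one]
  refine ENNReal.ofReal_le_ofReal ?_
  rw [← sub_div, add_sub_cancel_left, div_le_one (by linarith)]
  exact hd'

/-- A tie in a cube puts two points into a common slab at every level `k`. There are about `2 ^ k (τ
+ 1)` slabs, each with probability at most `4⁻ᵏ`, so the total tends to zero. -/
theorem IsPoissonPointProcess.ae_no_ties [IsProbabilityMeasure P] {X : Ω → Set (SpaceTime d)}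
    {m : Measure (SpaceTime d)} (hX : IsPoissonPointProcess X m P)
    (hm : ∀ k (z : Fin d → ℤ) j, m (slabCell k z j) ≤ (2⁻¹ : ℝ≥0∞) ^ k) {τ : ℝ} (hτ : 0 < τ)
    (hT : ∀ᵐ ω ∂P, ∀ v ∈ X ω, v.2 ∈ Set.Icc 0 τ) :
    ∀ᵐ ω ∂P, ∀ w ∈ X ω, ∀ v ∈ X ω, cell w.1 = cell v.1 → w.2 = v.2 → w = v := by
  have key : ∀ z : Fin d → ℤ, P {ω | (∀ v ∈ X ω, v.2 ∈ Set.Icc 0 τ) ∧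
      ∃ w ∈ X ω, ∃ v ∈ X ω, cell w.1 = z ∧ cell v.1 = z ∧ w.2 = v.2 ∧ w ≠ v} = 0 := by
    intro z
    have hk : ∀ k : ℕ, P {ω | (∀ v ∈ X ω, v.2 ∈ Set.Icc 0 τ) ∧
        ∃ w ∈ X ω, ∃ v ∈ X ω, cell w.1 = z ∧ cell v.1 = z ∧ w.2 = v.2 ∧ w ≠ v} ≤
        ENNReal.ofReal ((τ + 1) * (2⁻¹ : ℝ) ^ k) := by
      intro k
      have hsub : {ω | (∀ v ∈ X ω, v.2 ∈ Set.Icc 0 τ) ∧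
          ∃ w ∈ X ω, ∃ v ∈ X ω, cell w.1 = z ∧ cell v.1 = z ∧ w.2 = v.2 ∧ w ≠ v} ⊆
          ⋃ j ∈ Finset.range ⌊2 ^ k * (τ + 1)⌋₊, {ω | (X ω ∩ slabCell k z j).Nontrivial} := by
        rintro ω ⟨hω, w, hw, v, hv, hwz, hvz, ht, hne⟩
        have hw0 := (hω w hw).1
        have hwτ := (hω w hw).2
        refine Set.mem_iUnion₂.2 ⟨⌊2 ^ k * w.2⌋₊, ?_, w, ⟨hw, ?_⟩, v, ⟨hv, ?_⟩, hne⟩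
        · have h1 : (1 : ℝ) ≤ 2 ^ k := one_le_pow₀ (by norm_num)
          rw [Finset.mem_range, Nat.lt_iff_add_one_le, ← Nat.floor_add_one (by positivity)]
          exact Nat.floor_mono (by nlinarith)
        · exact hwz ▸ mem_slabCell k w hw0
        · rw [ht]
          exact hvz ▸ mem_slabCell k v (hω v hv).1
      calc _ ≤ ∑ j ∈ Finset.range ⌊2 ^ k * (τ + 1)⌋₊, ((2⁻¹ : ℝ≥0∞) ^ k) ^ 2 := by
            refine (measure_mono hsub).trans ((measure_biUnion_finset_le _ _).trans
              (Finset.sum_le_sum fun j _ => ?_))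
            refine (hX.measure_nontrivial_le (measurableSet_slabCell k z j)).trans ?_
            gcongr
            exact hm k z j
        _ = ENNReal.ofReal (⌊2 ^ k * (τ + 1)⌋₊ * ((2⁻¹ : ℝ) ^ k) ^ 2) := by
            rw [Finset.sum_const, Finset.card_range, nsmul_eq_mul,
              ENNReal.ofReal_mul (by positivity), ENNReal.ofReal_natCast,
              ENNReal.ofReal_pow (by positivity), ENNReal.ofReal_pow (by positivity),
              ENNReal.ofReal_inv_of_pos (by norm_num)]
            norm_num
        _ ≤ _ := by
            refine ENNReal.ofReal_le_ofReal ?_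
            calc _ ≤ (2 ^ k * (τ + 1)) * ((2⁻¹ : ℝ) ^ k) ^ 2 := by
                  gcongr
                  exact Nat.floor_le (by positivity)
              _ = _ := by rw [inv_pow]; field_simp
    have hlim : Tendsto (fun k : ℕ => ENNReal.ofReal ((τ + 1) * (2⁻¹ : ℝ) ^ k)) atTop (nhds 0) := by
      rw [← ENNReal.ofReal_zero]
      refine ENNReal.tendsto_ofReal ?_
      simpa using (tendsto_pow_atTop_nhds_zero_of_lt_one (r := (2⁻¹ : ℝ)) (by norm_num)
        (by norm_num)).const_mul (τ + 1)
    exact nonpos_iff_eq_zero.1 (ge_of_tendsto' hlim hk)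
  have hall := ae_all_iff.2 fun z : Fin d → ℤ => measure_eq_zero_iff_ae_notMem.1 (key z)
  filter_upwards [hall, hT] with ω h1 h2 w hw v hv hc ht
  by_contra hne
  exact h1 (cell w.1) ⟨h2, w, hw, v, hv, rfl, hc.symm, ht, hne⟩

theorem isRegularInput_continuum [IsProbabilityMeasure P] (hd : 1 ≤ d)
    {X : Ω → Set (SpaceTime d)} {τ : ℝ} (hτ : 0 < τ)
    (hX : IsPoissonPointProcess X (continuumIntensity d τ) P) :
    IsRegularInput X (continuumIntensity d τ) P := by
  have hT := IsPoissonPointProcess.ae_snd_mem measurableSet_Icc hX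
  have hslab : ∀ k (z : Fin d → ℤ) j, continuumIntensity d τ (slabCell k z j) ≤
    (2⁻¹ : ℝ≥0∞) ^ k := prod_slabCell_le (volume_cell_preimage_le hd)
  refine ⟨hX, hslab, prod_cellUpTo_ne_top (volume_cell_preimage_le hd) fun t ht => ht.1, ?_, ?_, ?_, ?_⟩
  · filter_upwards [hT] with ω hω v hv using (hω v hv).1
  -- No ball arrives after `τ`; for `s < τ` the factor `exp τ` makes the bound at least 1, so the
  -- whole space serves as the exceptional event.
  · refine ⟨Real.exp τ, (Real.exp_pos _).le, fun z s => ?_⟩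
    by_cases hs : s < τ
    · refine ⟨Set.univ, ?_, by simp⟩
      rw [measure_univ, ← Real.exp_add, ← ENNReal.ofReal_one]
      exact ENNReal.ofReal_le_ofReal (Real.one_le_exp (by linarith))
    · refine ⟨∅, by simp, ?_⟩
      filter_upwards [hT] with ω hω _ R w hw _
      exact (hω w hw.mem.1).2.trans (not_lt.1 hs)
  · filter_upwards [hX.ae_no_ties hslab hτ hT] with ω hω R w v hw hv hc
    exact hω w hw.mem.1 v hv.mem.1 hc (hw.time_eq hv (dist_lt_two_of_cell_eq hc.symm))
  · intro A hA
    refine ⟨interior A, isOpen_interior.measurableSet, ?_⟩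
    filter_upwards [IsPoissonPointProcess.ae_fst_notMem hX isClosed_frontier.measurableSet hA]
      with ω hω
    ext w
    refine ⟨fun hw => ⟨hw.1, ?_⟩, fun hw => ⟨hw.1, interior_subset hw.2⟩⟩
    by_contra hi
    exact hω w hw.1 ⟨subset_closure hw.2, hi⟩

/-- The lattice point `z` as a point of space. -/
def latticePoint (z : Fin d → ℤ) : EuclideanSpace ℝ (Fin d) := WithLp.toLp 2 fun i => (z i : ℝ)

theorem cell_latticePoint (z : Fin d → ℤ) : cell (latticePoint z) = fun i => (d : ℤ) * z i := by
  ext i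
  simp only [cell, latticePoint]
  exact_mod_cast Int.floor_intCast (R := ℝ) ((d : ℤ) * z i)

theorem cell_latticePoint_injective (hd : 1 ≤ d) :
    Function.Injective fun z : Fin d → ℤ => cell (latticePoint z) := by
  intro z z' h
  simp only [cell_latticePoint] at h
  ext i
  have := congrFun h i
  exact mul_left_cancel₀ (by exact_mod_cast (by omega : d ≠ 0)) this

/-- The counting measure of the lattice. -/
noncomputable def latticeMeasure (d : ℕ) : Measure (EuclideanSpace ℝ (Fin d)) :=
  Measure.sum fun z : Fin d → ℤ => Measure.dirac (latticePoint z)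

theorem latticeIntensity_eq :
    latticeIntensity d = (latticeMeasure d).prod (volume.restrict (Set.Ici 0)) := rfl

theorem latticeMeasure_apply {B : Set (EuclideanSpace ℝ (Fin d))} (hB : MeasurableSet B) :
    latticeMeasure d B = ∑' z, B.indicator 1 (latticePoint z) := by
  rw [latticeMeasure, Measure.sum_apply _ hB]
  simp_rw [Measure.dirac_apply' _ hB]

theorem latticeMeasure_cell_preimage_le (hd : 1 ≤ d) (z : Fin d → ℤ) :
    latticeMeasure d (cell ⁻¹' {z}) ≤ 1 := by
  rw [latticeMeasure_apply (measurableSet_cell_preimage z)]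
  by_cases h : ∃ z0, cell (latticePoint z0) = z
  · obtain ⟨z0, hz0⟩ := h
    rw [tsum_eq_single z0]
    · unfold Set.indicator
      split_ifs <;> simp
    · intro z' hz'
      refine Set.indicator_of_notMem ?_ _
      intro hmem
      exact hz' (cell_latticePoint_injective hd (Eq.trans hmem hz0.symm))
  · have h0 : ∀ z', (cell ⁻¹' {z}).indicator (1 : EuclideanSpace ℝ (Fin d) → ℝ≥0∞)
        (latticePoint z') = 0 := by
      intro z'
      refine Set.indicator_of_notMem ?_ _
      exact fun hmem => h ⟨z', hmem⟩
    rw [ENNReal.tsum_eq_zero.2 h0]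
    exact zero_le_one

theorem latticeMeasure_singleton (hd : 1 ≤ d) (z : Fin d → ℤ) :
    latticeMeasure d {latticePoint z} = 1 := by
  rw [latticeMeasure_apply (measurableSet_singleton _), tsum_eq_single z]
  · simp
  · intro z' hz'
    refine Set.indicator_of_notMem ?_ _
    intro hmem
    exact hz' (cell_latticePoint_injective hd (congrArg cell hmem))

theorem isRegularInput_lattice [IsProbabilityMeasure P] (hd : 1 ≤ d)
    {X : Ω → Set (SpaceTime d)} (hX : IsPoissonPointProcess X (latticeIntensity d) P) :
    IsRegularInput X (latticeIntensity d) P := by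
  have hT := IsPoissonPointProcess.ae_snd_mem measurableSet_Ici hX
  have hc : (Set.range (latticePoint (d := d))).Countable := Set.countable_range _
  have hlat : ∀ᵐ ω ∂P, ∀ v ∈ X ω, v.1 ∈ Set.range (latticePoint (d := d)) := by
    have h0 : latticeMeasure d (Set.range (latticePoint (d := d)))ᶜ = 0 := by
      rw [latticeMeasure_apply hc.measurableSet.compl]
      simp
    filter_upwards [IsPoissonPointProcess.ae_fst_notMem hX hc.measurableSet.compl h0] with ω hω v hv
    exact not_not.1 (hω v hv)
  refine ⟨hX, prod_slabCell_le (latticeMeasure_cell_preimage_le hd),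
    prod_cellUpTo_ne_top (latticeMeasure_cell_preimage_le hd) subset_rfl, hT, ?_, ?_, ?_⟩
  · refine ⟨1, zero_le_one, fun z s => ?_⟩
    rw [one_mul]
    by_cases hs : s < 0
    · refine ⟨Set.univ, ?_, by simp⟩
      rw [measure_univ, ← ENNReal.ofReal_one]
      exact ENNReal.ofReal_le_ofReal (Real.one_le_exp (by linarith))
    by_cases h : ∃ z0, cell (latticePoint z0) = z
    · obtain ⟨z0, hz0⟩ := h
      have hm : latticeIntensity d ({latticePoint z0} ×ˢ Set.Icc 0 s) = ENNReal.ofReal s := by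
        rw [latticeIntensity_eq, Measure.prod_prod, latticeMeasure_singleton hd,
          Measure.restrict_apply measurableSet_Icc,
          Set.inter_eq_self_of_subset_left fun t ht => ht.1, Real.volume_Icc]
        simp
      have hB : MeasurableSet (({latticePoint z0} : Set (EuclideanSpace ℝ (Fin d))) ×ˢ
        Set.Icc (0 : ℝ) s) := (measurableSet_singleton _).prod measurableSet_Icc
      -- Off the event of no arrival at the site during `[0, s]`, the first arrival there is at most
      -- `s`, and no later ball at the site can be packed. If a restriction keeps one ball of the
      -- site, it keeps all of them, so the event is the same for every `R`.
      refine ⟨{ω | X ω ∩ ({latticePoint z0} ×ˢ Set.Icc 0 s) = ∅}, ?_, ?_⟩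
      · rw [hX.measure_empty hB (by rw [hm]; exact ENNReal.ofReal_ne_top), hm,
          ENNReal.toReal_ofReal (not_lt.1 hs)]
      · filter_upwards [hlat] with ω hω hL R w hw hwz
        obtain ⟨v, hv, hv1, hv2⟩ := Set.nonempty_iff_ne_empty.2 hL
        obtain ⟨z', hz'⟩ := hω w hw.mem.1
        have : z' = z0 := cell_latticePoint_injective hd
          (show cell (latticePoint z') = cell (latticePoint z0) by rw [hz', hwz, hz0])
        have hvw : v.1 = w.1 := by rw [← hz', this]; exact hv1
        exact (hw.time_le ⟨hv, hvw ▸ hw.mem.2⟩ hvw).trans hv2.2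
    · refine ⟨∅, by simp, ?_⟩
      filter_upwards [hlat] with ω hω _ R w hw hwz
      obtain ⟨z', hz'⟩ := hω w hw.mem.1
      exact absurd ⟨z', hz' ▸ hwz⟩ h
  · filter_upwards [hlat] with ω hω R w v hw hv hc
    obtain ⟨z, hz⟩ := hω w hw.mem.1
    obtain ⟨z', hz'⟩ := hω v hv.mem.1
    have : z = z' := cell_latticePoint_injective hd
      (show cell (latticePoint z) = cell (latticePoint z') by rw [hz, hz', hc])
    exact hv.eq_of_fst_eq hw (by rw [← hz, ← hz', this])
  · intro A _
    -- All centres are lattice points, and a subset of the countable lattice is measurable.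
    refine ⟨A ∩ Set.range latticePoint, (hc.mono Set.inter_subset_right).measurableSet, ?_⟩
    filter_upwards [hlat] with ω hω
    ext w
    exact ⟨fun hw => ⟨hw.1, hw.2, hω w hw.1⟩, fun hw => ⟨hw.1, hw.2.1⟩⟩

end Inputs

/-! ### Localization and decorrelation -/

section Localization

variable {d : ℕ} {Ω : Type*} [mΩ : MeasurableSpace Ω] {P : Measure Ω} [IsProbabilityMeasure P]
  {X : Ω → Set (SpaceTime d)} {m : Measure (SpaceTime d)}

/-- Up to an event whose probability decays exponentially in `n`, the packing in a grid cube
depends only on the balls within `n` steps of this cube. -/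
theorem IsRegularInput.exists_localization (hX : IsRegularInput X m P) :
    ∃ C c : ℝ, 0 ≤ C ∧ 0 < c ∧ ∀ (n : ℕ) (z : Fin d → ℤ), ∃ Bad : Set Ω,
      P Bad ≤ ENNReal.ofReal (C * Real.exp (-(c * n))) ∧ ∀ᵐ ω ∂P, ω ∉ Bad →
        ∀ R B, nearby n z ⊆ B → ∀ x, cell x = z →
          (x ∈ packing (restrictInput (X ω) R) ↔ x ∈ packing (restrictInput (X ω) (R ∩ B))) := by
  obtain ⟨D, hD, hlate⟩ := hX.late
  obtain ⟨c, hc, hcn⟩ := exists_pos_forall_chain_bound_le (M := (4 * d + 1) ^ d)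
    (one_le_pow₀ (by linarith [(Nat.cast_nonneg d : (0 : ℝ) ≤ d)]))
  refine ⟨D * Real.exp 1 + 1, min c 1, by positivity, by positivity, fun n z => ?_⟩
  -- A threshold linear in `n` makes late arrivals exponentially rare, while `s + 1 = c * (n + 1)`
  -- is what `hcn` needs to rule out long chains.
  obtain ⟨L, hL, hLω⟩ := hlate z (c * (n + 1) - 1)
  have hs : 0 ≤ c * ((n : ℝ) + 1) - 1 + 1 := by
    rw [sub_add_cancel]; positivity
  have hchain := hX.poisson.measure_hasChain_le hX.slab_le hX.nonneg n z hs
  -- One bad event serves all `R` and `B`, since chains of a restricted input are chains of the full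
  -- input and `late` is uniform in `R`.
  refine ⟨L ∪ {ω | ∃ w ∈ X ω, cell w.1 = z ∧ w.2 ≤ c * (n + 1) - 1 ∧ HasChain (X ω) n w}, ?_, ?_⟩
  · refine (measure_union_le _ _).trans ((add_le_add hL hchain).trans ?_)
    rw [← ENNReal.ofReal_add (by positivity) (by positivity)]
    refine ENNReal.ofReal_le_ofReal ?_
    rw [sub_add_cancel, add_mul, one_mul]
    refine add_le_add ?_ ((hcn n).trans ?_)
    · rw [mul_assoc, ← Real.exp_add]
      gcongr
      have : min c 1 * n ≤ c * n := by gcongr; exact min_le_left _ _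
      linarith
    · refine Real.exp_le_exp.2 ?_
      have : min c 1 * n ≤ 1 * n := by gcongr; exact min_le_right _ _
      linarith
  · filter_upwards [hLω] with ω hω hbad R B hB x hx
    rw [Set.mem_union, not_or] at hbad
    have hno : ∀ w ∈ X ω, cell w.1 = z → w.2 ≤ c * (n + 1) - 1 → ¬ HasChain (X ω) n w :=
      fun w hw hwz hws hch => hbad.2 ⟨w, hw, hwz, hws, hch⟩
    constructor
    · rintro ⟨w, hw, rfl⟩
      refine ⟨w, ?_, rfl⟩
      have hws := hω hbad.1 R w hw hx
      have hnc : ¬ HasChain (restrictInput (X ω) R) n w := fun h =>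
        hno w (Fate.mem hw).1 hx hws (h.mono (restrictInput_subset _ _))
      rw [← restrictInput_restrictInput]
      exact (fate_restrictInput_iff hnc (Fate.mem hw) (hx ▸ hB)).2 hw
    · rintro ⟨w, hw, rfl⟩
      refine ⟨w, ?_, rfl⟩
      have hws := hω hbad.1 _ w hw hx
      have hwR : w ∈ restrictInput (X ω) R := ⟨(Fate.mem hw).1, (Fate.mem hw).2.1⟩
      have hnc : ¬ HasChain (restrictInput (X ω) R) n w := fun h =>
        hno w hwR.1 hx hws (h.mono (restrictInput_subset _ _))
      rw [← restrictInput_restrictInput] at hw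
      exact (fate_restrictInput_iff hnc hwR (hx ▸ hB)).1 hw

/-- The event that some point of `C` belongs to the packing on `R₁`, but not to the one on `R₂`. -/
def differEvent (X : Ω → Set (SpaceTime d)) (C R₁ R₂ : Set (EuclideanSpace ℝ (Fin d))) : Set Ω :=
  {ω | ((C ∩ packing (restrictInput (X ω) R₁)) \ packing (restrictInput (X ω) R₂)).Nonempty}

omit [IsProbabilityMeasure P] in
theorem IsRegularInput.ae_locallyFinite (hX : IsRegularInput X m P) :
    ∀ᵐ ω ∂P, LocallyFinite (X ω) := by
  have h := ae_all_iff.2 fun z => ae_all_iff.2 fun k =>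
    hX.poisson.ae_finite (measurableSet_cellUpTo z k) (hX.finite z k)
  exact h

omit mΩ in
theorem measurableCounts_restrictInput_countsAlgebra (X : Ω → Set (SpaceTime d))
    {R B : Set (EuclideanSpace ℝ (Fin d))} (hR : MeasurableSet R) :
    @MeasurableCounts Ω _ (countsAlgebra X (Prod.fst ⁻¹' B)) _
      fun ω => restrictInput (X ω) (R ∩ B) := by
  intro C hC
  have := measurable_countsAlgebra X (Prod.fst ⁻¹' B) ((measurable_fst hR).inter hC)
  convert this using 3 with ω
  ext w
  simp only [RandomPacking.restrictInput, Set.mem_inter_iff, Set.mem_ofPred_eq, Set.mem_preimage]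
  tauto

omit [IsProbabilityMeasure P] in
/-- On a region `B`, the event of differing packings is almost surely equal to an event that only
depends on the balls with centre in `B`. -/
theorem IsRegularInput.exists_measurableSet_differEvent (hX : IsRegularInput X m P)
    {C R₁ R₂ B : Set (EuclideanSpace ℝ (Fin d))} (hC : MeasurableSet C) (hR₁ : MeasurableSet R₁)
    (hR₂ : MeasurableSet R₂) :
    ∃ J, MeasurableSet[countsAlgebra X (Prod.fst ⁻¹' B)] J ∧
      ∀ᵐ ω ∂P, ω ∈ J ↔ ω ∈ differEvent X C (R₁ ∩ B) (R₂ ∩ B) := by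
  have h1 := @MeasurableCounts.regularize _ _ (countsAlgebra X (Prod.fst ⁻¹' B)) _
    (measurableCounts_restrictInput_countsAlgebra X (B := B) hR₁)
  have h2 := @MeasurableCounts.regularize _ _ (countsAlgebra X (Prod.fst ⁻¹' B)) _
    (measurableCounts_restrictInput_countsAlgebra X (B := B) hR₂)
  refine ⟨_, @MeasurableCounts.measurableSet_packing_diff _ _ (countsAlgebra X (Prod.fst ⁻¹' B))
    _ _ h1 (fun _ => locallyFinite_regularize _) h2 (fun _ => locallyFinite_regularize _) _ hC, ?_⟩
  filter_upwards [hX.ae_locallyFinite] with ω hω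
  rw [(hω.mono (restrictInput_subset _ _)).regularize_eq,
    (hω.mono (restrictInput_subset _ _)).regularize_eq]
  rfl

omit [IsProbabilityMeasure P] in
theorem IsRegularInput.nullMeasurableSet_differEvent (hX : IsRegularInput X m P)
    {C R₁ R₂ : Set (EuclideanSpace ℝ (Fin d))} (hC : MeasurableSet C) (hR₁ : MeasurableSet R₁)
    (hR₂ : MeasurableSet R₂) : NullMeasurableSet (differEvent X C R₁ R₂) P := by
  obtain ⟨J, hJ, hJE⟩ := hX.exists_measurableSet_differEvent (B := Set.univ) hC hR₁ hR₂
  rw [Set.inter_univ, Set.inter_univ] at hJE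
  refine ⟨J, countsAlgebra_le hX.poisson.measurableCounts (measurable_fst .univ) _ hJ, ?_⟩
  filter_upwards [hJE] with ω hω
  exact propext hω.symm

theorem measurableSet_nearby (n : ℕ) (z : Fin d → ℤ) : MeasurableSet (nearby n z) :=
  measurable_cell (MeasurableSet.of_discrete (s := {y | dist y z ≤ 2 * d * n}))

theorem disjoint_nearby {n : ℕ} {z z' : Fin d → ℤ} (h : 4 * d * n < dist z z') :
    Disjoint (nearby n z) (nearby n z') := by
  refine Set.disjoint_left.2 fun x (hx : dist _ _ ≤ _) (hx' : dist _ _ ≤ _) => ?_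
  have := dist_triangle_left z z' (cell x)
  linarith

/-- Packing discrepancies in distant grid cubes are almost independent. -/
theorem IsRegularInput.exists_measure_inter_le (hX : IsRegularInput X m P) :
    ∃ K c : ℝ, 0 ≤ K ∧ 0 < c ∧
      (∀ (n : ℕ) (z : Fin d → ℤ) (A C R : Set (EuclideanSpace ℝ (Fin d))),
        nearby n z ⊆ A → C ⊆ cell ⁻¹' {z} →
          P (differEvent X C R (R ∩ A)) ≤ ENNReal.ofReal (K * Real.exp (-(c * n))) ∧
          P (differEvent X C (R ∩ A) R) ≤ ENNReal.ofReal (K * Real.exp (-(c * n)))) ∧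
      ∀ (n : ℕ) (z z' : Fin d → ℤ) (C C' R₁ R₂ : Set (EuclideanSpace ℝ (Fin d))),
        4 * d * n < dist z z' → C ⊆ cell ⁻¹' {z} → C' ⊆ cell ⁻¹' {z'} → MeasurableSet C →
        MeasurableSet C' → MeasurableSet R₁ → MeasurableSet R₂ →
          P (differEvent X C R₁ R₂ ∩ differEvent X C' R₁ R₂) ≤
            P (differEvent X C R₁ R₂) * P (differEvent X C' R₁ R₂) +
              ENNReal.ofReal (K * Real.exp (-(c * n))) := by
  obtain ⟨K, c, hK, hc, hloc⟩ := hX.exists_localization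
  -- Replacing two events by local ones costs two errors in the joint probability and two more in
  -- the product.
  refine ⟨4 * K, c, by positivity, hc, fun n z A C R hA hC => ?_,
    fun n z z' C C' R₁ R₂ hdist hC hC' hCm hCm' hR₁ hR₂ => ?_⟩
  · obtain ⟨Bad, hBad, hω⟩ := hloc n z
    have hle : ENNReal.ofReal (K * Real.exp (-(c * n))) ≤
        ENNReal.ofReal (4 * K * Real.exp (-(c * n))) := by
      refine ENNReal.ofReal_le_ofReal ?_
      gcongr
      linarith
    constructor
    · refine (measure_mono_ae ?_).trans (hBad.trans hle)
      filter_upwards [hω] with ω hω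
      rintro ⟨x, ⟨hxC, hx⟩, hx'⟩
      by_contra hbad
      exact hx' ((hω hbad R A hA x (hC hxC)).1 hx)
    · refine (measure_mono_ae ?_).trans (hBad.trans hle)
      filter_upwards [hω] with ω hω
      rintro ⟨x, ⟨hxC, hx⟩, hx'⟩
      by_contra hbad
      exact hx' ((hω hbad R A hA x (hC hxC)).2 hx)
  · set b := ENNReal.ofReal (K * Real.exp (-(c * n))) with hb
    have h4 : ENNReal.ofReal (4 * K * Real.exp (-(c * n))) = b + b + (b + b) := by
      rw [hb, ← ENNReal.ofReal_add (by positivity) (by positivity),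
        ← ENNReal.ofReal_add (by positivity) (by positivity)]
      congr 1
      ring
    have key : ∀ (z : Fin d → ℤ) (C : Set (EuclideanSpace ℝ (Fin d))), C ⊆ cell ⁻¹' {z} →
        MeasurableSet C → ∃ J Bad, MeasurableSet[countsAlgebra X (Prod.fst ⁻¹' nearby n z)] J ∧
          P Bad ≤ b ∧ ∀ᵐ ω ∂P, ω ∉ Bad → (ω ∈ J ↔ ω ∈ differEvent X C R₁ R₂) := by
      intro z C hC hCm
      obtain ⟨Bad, hBad, hω⟩ := hloc n z
      obtain ⟨J, hJ, hJE⟩ :=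
        hX.exists_measurableSet_differEvent (B := nearby n z) hCm hR₁ hR₂
      refine ⟨J, Bad, hJ, hBad, ?_⟩
      filter_upwards [hω, hJE] with ω h1 h2 hbad
      rw [h2]
      refine exists_congr fun x => ?_
      simp only [Set.mem_sdiff, Set.mem_inter_iff]
      constructor
      · rintro ⟨⟨hx, hx1⟩, hx2⟩
        exact ⟨⟨hx, (h1 hbad R₁ _ subset_rfl x (hC hx)).2 hx1⟩,
          fun h => hx2 ((h1 hbad R₂ _ subset_rfl x (hC hx)).1 h)⟩
      · rintro ⟨⟨hx, hx1⟩, hx2⟩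
        exact ⟨⟨hx, (h1 hbad R₁ _ subset_rfl x (hC hx)).1 hx1⟩,
          fun h => hx2 ((h1 hbad R₂ _ subset_rfl x (hC hx)).2 h)⟩
    obtain ⟨J, Bad, hJ, hBad, hJω⟩ := key z C hC hCm
    obtain ⟨J', Bad', hJ', hBad', hJω'⟩ := key z' C' hC' hCm'
    have hind : P (J ∩ J') = P J * P J' :=
      (Indep_iff _ _ P).1 (hX.poisson.indep_countsAlgebra (measurable_fst (measurableSet_nearby n z))
        (measurable_fst (measurableSet_nearby n z'))
        ((disjoint_nearby hdist).preimage _)) _ _ hJ hJ'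
    have hPJ : ∀ {J Bad E : Set Ω}, P Bad ≤ b → (∀ᵐ ω ∂P, ω ∉ Bad → (ω ∈ J ↔ ω ∈ E)) →
        P J ≤ P E + b := by
      intro J Bad E hBad h
      refine (measure_mono_ae (t := E ∪ Bad) ?_).trans
        ((measure_union_le _ _).trans (by gcongr))
      filter_upwards [h] with ω hω
      intro hJω
      by_cases hbad : ω ∈ Bad
      · exact Or.inr hbad
      · exact Or.inl ((hω hbad).1 hJω)
    set E := differEvent X C R₁ R₂
    set E' := differEvent X C' R₁ R₂
    calc P (E ∩ E') ≤ P ((J ∩ J') ∪ (Bad ∪ Bad')) := by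
          refine measure_mono_ae ?_
          filter_upwards [hJω, hJω'] with ω h1 h2
          rintro ⟨hE, hE'⟩
          by_cases hb1 : ω ∈ Bad
          · exact Or.inr (Or.inl hb1)
          by_cases hb2 : ω ∈ Bad'
          · exact Or.inr (Or.inr hb2)
          exact Or.inl ⟨(h1 hb1).2 hE, (h2 hb2).2 hE'⟩
      _ ≤ P J * P J' + (b + b) := by
          refine (measure_union_le _ _).trans ?_
          rw [hind]
          gcongr
          exact (measure_union_le _ _).trans (add_le_add hBad hBad')
      _ ≤ P E * P E' + (b + b) + (b + b) := by
          gcongr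
          calc P J * P J' ≤ (P E + b) * P J' := by gcongr; exact hPJ hBad hJω
            _ = P E * P J' + b * P J' := by ring
            _ ≤ P E * (P E' + b) + b * 1 := by
                gcongr
                · exact hPJ hBad' hJω'
                · exact prob_le_one
            _ = P E * P E' + (P E * b + b) := by ring
            _ ≤ P E * P E' + (1 * b + b) := by gcongr; exact prob_le_one
            _ = _ := by rw [one_mul]
      _ = _ := by rw [h4, add_assoc]

end Localization

/-! ### Moments of the number of discrepancies -/

section Moments

variable {Ω : Type*} [MeasurableSpace Ω] {P : Measure Ω}

theorem lintegral_tsum_indicator {ι : Type*} [Countable ι] {E : ι → Set Ω}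
    (hE : ∀ z, NullMeasurableSet (E z) P) :
    ∫⁻ ω, ∑' z, (E z).indicator 1 ω ∂P = ∑' z, P (E z) := by
  have hm : ∀ z, AEMeasurable ((E z).indicator (1 : Ω → ℝ≥0∞)) P := fun z =>
    AEMeasurable.indicator₀ (f := 1) aemeasurable_const (hE z)
  rw [lintegral_tsum hm]
  exact tsum_congr fun z => lintegral_indicator_one₀ (hE z)

theorem lintegral_tsum_indicator_sq {ι : Type*} [Countable ι] {E : ι → Set Ω}
    (hE : ∀ z, NullMeasurableSet (E z) P) :
    ∫⁻ ω, (∑' z, (E z).indicator 1 ω) ^ 2 ∂P = ∑' z, ∑' z', P (E z ∩ E z') := by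
  have h : ∀ ω, (∑' z, (E z).indicator (1 : Ω → ℝ≥0∞) ω) ^ 2 =
      ∑' z, ∑' z', (E z ∩ E z').indicator 1 ω := by
    intro ω
    rw [sq, ← ENNReal.tsum_mul_right]
    refine tsum_congr fun z => ?_
    rw [← ENNReal.tsum_mul_left]
    refine tsum_congr fun z' => ?_
    rw [Set.inter_indicator_one, Pi.mul_apply]
  have hm : ∀ z, AEMeasurable (fun ω => ∑' z', (E z ∩ E z').indicator (1 : Ω → ℝ≥0∞) ω) P :=
    fun z => AEMeasurable.tsum fun z' =>
      AEMeasurable.indicator₀ (f := 1) aemeasurable_const ((hE z).inter (hE z'))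
  simp_rw [h]
  rw [lintegral_tsum hm]
  exact tsum_congr fun z => lintegral_tsum_indicator fun z' => (hE z).inter (hE z')

/-- Moment bounds for a number of points from bounds on Lebesgue integrals. -/
theorem moments_of_lintegral_le [IsProbabilityMeasure P] {E : Type*} {S : Ω → Set E}
    {N : Ω → ℝ≥0∞} (hN : AEMeasurable N P) (hS : ∀ᵐ ω ∂P, ((S ω).encard : ℝ≥0∞) = N ω) {a v : ℝ}
    (ha0 : 0 ≤ a) (hv0 : 0 ≤ v) (ha : ∫⁻ ω, N ω ∂P ≤ ENNReal.ofReal a)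
    (hv : ∫⁻ ω, N ω ^ 2 ∂P ≤ (∫⁻ ω, N ω ∂P) ^ 2 + ENNReal.ofReal v) :
    (∀ᵐ ω ∂P, (S ω).Finite) ∧ MemLp (fun ω => ((S ω).ncard : ℝ)) 2 P ∧
      ∫ ω, ((S ω).ncard : ℝ) ∂P ≤ a ∧ variance (fun ω => ((S ω).ncard : ℝ)) P ≤ v := by
  have hNtop : ∫⁻ ω, N ω ∂P ≠ ∞ := (ha.trans_lt ENNReal.ofReal_lt_top).ne
  have hN2top : ∫⁻ ω, N ω ^ 2 ∂P ≠ ∞ := (hv.trans_lt (by finiteness)).ne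
  have hfin : ∀ᵐ ω ∂P, (S ω).Finite := by
    filter_upwards [hS, ae_lt_top' hN hNtop] with ω h1 h2
    rw [← Set.encard_lt_top_iff]
    rw [← h1] at h2
    exact_mod_cast h2
  have hcard : ∀ᵐ ω ∂P, ENNReal.ofReal ((S ω).ncard : ℝ) = N ω := by
    filter_upwards [hS, hfin] with ω h1 h2
    rw [← h1, ENNReal.ofReal_natCast, ← h2.cast_ncard_eq]
    simp
  have hmeas : AEStronglyMeasurable (fun ω => ((S ω).ncard : ℝ)) P := by
    refine AEMeasurable.aestronglyMeasurable (hN.ennreal_toReal.congr ?_)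
    filter_upwards [hcard] with ω h
    rw [← h, ENNReal.toReal_ofReal (by positivity)]
  have h1 : ∫ ω, ((S ω).ncard : ℝ) ∂P = (∫⁻ ω, N ω ∂P).toReal := by
    rw [integral_eq_lintegral_of_nonneg_ae (.of_forall fun ω => by positivity) hmeas,
      lintegral_congr_ae hcard]
  have hcard2 : ∀ᵐ ω ∂P, ENNReal.ofReal (((S ω).ncard : ℝ) ^ 2) = N ω ^ 2 := by
    filter_upwards [hcard] with ω h
    rw [← h, ENNReal.ofReal_pow (by positivity)]
  have hmeas2 : AEStronglyMeasurable (fun ω => ((S ω).ncard : ℝ) ^ 2) P := hmeas.pow 2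
  have h2 : ∫ ω, ((S ω).ncard : ℝ) ^ 2 ∂P = (∫⁻ ω, N ω ^ 2 ∂P).toReal := by
    rw [integral_eq_lintegral_of_nonneg_ae (.of_forall fun ω => by positivity) hmeas2,
      lintegral_congr_ae hcard2]
  have hLp : MemLp (fun ω => ((S ω).ncard : ℝ)) 2 P := by
    rw [memLp_two_iff_integrable_sq hmeas]
    refine ⟨hmeas2, ?_⟩
    rw [hasFiniteIntegral_iff_ofReal (.of_forall fun ω => by positivity),
      lintegral_congr_ae hcard2]
    exact hN2top.lt_top
  refine ⟨hfin, hLp, ?_, ?_⟩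
  · rw [h1]
    exact ENNReal.toReal_le_of_le_ofReal ha0 ha
  · rw [variance_eq_sub hLp]
    change ∫ ω, ((S ω).ncard : ℝ) ^ 2 ∂P - _ ≤ v
    rw [h1, h2]
    have := ENNReal.toReal_mono (by finiteness) hv
    rw [ENNReal.toReal_add (by finiteness) (by finiteness), ENNReal.toReal_pow,
      ENNReal.toReal_ofReal hv0] at this
    linarith

end Moments

/-! ### Exponential decay and summation over the grid -/

section Decay

variable {d : ℕ}

/-- The largest admissible integer is `n = ⌈ρ / K⌉₊ - 1`, and rounding costs the factor `exp c`. For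
`ρ = 0` no `n` is admissible and `q ≤ 1` takes over, hence the summand 1. -/
theorem le_exp_of_forall_nat {q : ℝ≥0∞} (hq : q ≤ 1) {C c K ρ : ℝ} (hC : 0 ≤ C) (hc : 0 < c)
    (hK : 0 < K) (hρ : 0 ≤ ρ)
    (h : ∀ n : ℕ, K * n < ρ → q ≤ ENNReal.ofReal (C * Real.exp (-(c * n)))) :
    q ≤ ENNReal.ofReal ((C * Real.exp c + 1) * Real.exp (-(c / K * ρ))) := by
  rcases hρ.eq_or_lt with rfl | hρ
  · refine hq.trans ?_
    rw [← ENNReal.ofReal_one]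
    refine ENNReal.ofReal_le_ofReal ?_
    have : 0 ≤ C * Real.exp c := by positivity
    simp [this]
  · have hpos : 0 < ⌈ρ / K⌉₊ := Nat.ceil_pos.2 (by positivity)
    obtain ⟨n, hn⟩ : ∃ n, ⌈ρ / K⌉₊ = n + 1 := ⟨⌈ρ / K⌉₊ - 1, by omega⟩
    have h1 : ρ / K ≤ n + 1 := by
      have := Nat.le_ceil (ρ / K)
      rw [hn] at this
      exact_mod_cast this
    have h2 : (n : ℝ) < ρ / K := Nat.lt_ceil.1 (by omega)
    refine (h n (by rwa [lt_div_iff₀ hK, mul_comm] at h2)).trans (ENNReal.ofReal_le_ofReal ?_)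
    have h3 : Real.exp (-(c * n)) ≤ Real.exp c * Real.exp (-(c / K * ρ)) := by
      rw [← Real.exp_add]
      refine Real.exp_le_exp.2 ?_
      have : c / K * ρ = c * (ρ / K) := by ring
      rw [this]
      nlinarith
    have h4 : 0 ≤ Real.exp (-(c / K * ρ)) := (Real.exp_pos _).le
    calc C * Real.exp (-(c * n)) ≤ C * (Real.exp c * Real.exp (-(c / K * ρ))) := by gcongr
      _ ≤ _ := by nlinarith

/-- The exponentially decaying weight `exp (-c |z - y|)`. -/
noncomputable def weight (c : ℝ) (z y : Fin d → ℤ) : ℝ≥0∞ :=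
  ENNReal.ofReal (Real.exp (-(c * dist z y)))

theorem tsum_weight_eq (c : ℝ) (y : Fin d → ℤ) : ∑' z, weight c z y = ∑' z, weight (d := d) c z 0 := by
  rw [← (Equiv.subRight y).tsum_eq fun z => weight c z 0]
  refine tsum_congr fun z => ?_
  simp [weight, dist_eq_norm]

theorem tsum_prod_fin_eq_pow (f : ℤ → ℝ≥0∞) (n : ℕ) :
    ∑' z : Fin n → ℤ, ∏ i, f (z i) = (∑' k, f k) ^ n := by
  induction n with
  | zero => simp
  | succ n ih =>
    rw [← (Fin.consEquiv fun _ => ℤ).tsum_eq, ENNReal.tsum_prod']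
    simp only [Fin.consEquiv_apply, Fin.prod_univ_succ, Fin.cons_zero, Fin.cons_succ]
    simp_rw [ENNReal.tsum_mul_left, ih, ENNReal.tsum_mul_right]
    rw [pow_succ, mul_comm]

/-- The sup distance dominates the coordinate sum divided by `d + 1`, so the weight is at most a
product of one-dimensional geometric terms; `d + 1` avoids division by zero. -/
theorem tsum_weight_ne_top {c : ℝ} (hc : 0 < c) : ∑' z, weight (d := d) c z 0 ≠ ∞ := by
  set a : ℝ := Real.exp (-(c / (d + 1))) with ha
  have ha1 : a < 1 := by
    rw [← Real.exp_zero]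
    exact Real.exp_lt_exp.2 (neg_lt_zero.2 (by positivity))
  have hle : ∀ z : Fin d → ℤ, weight c z 0 ≤ ∏ i, ENNReal.ofReal (a ^ (z i).natAbs) := by
    intro z
    rw [weight, ← ENNReal.ofReal_prod_of_nonneg fun i _ => by positivity]
    refine ENNReal.ofReal_le_ofReal ?_
    rw [Finset.prod_pow_eq_pow_sum, ha, ← Real.exp_nat_mul]
    refine Real.exp_le_exp.2 ?_
    have h1 : ((∑ i, (z i).natAbs : ℕ) : ℝ) ≤ (d + 1) * dist z 0 := by
      push_cast
      calc ∑ i, (((z i).natAbs : ℕ) : ℝ) ≤ ∑ _i : Fin d, dist z 0 := by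
            refine Finset.sum_le_sum fun i _ => ?_
            have := dist_le_pi_dist z 0 i
            rw [Int.dist_eq] at this
            simpa using this
        _ = d * dist z 0 := by simp
        _ ≤ _ := by gcongr; linarith
    have h2 : (0 : ℝ) < c / (d + 1) := by positivity
    calc ((∑ i, (z i).natAbs : ℕ) : ℝ) * -(c / (d + 1))
        = -(c / (d + 1) * ((∑ i, (z i).natAbs : ℕ) : ℝ)) := by ring
      _ ≥ -(c / (d + 1) * ((d + 1) * dist z 0)) := by gcongr
      _ = -(c * dist z 0) := by field_simp
  refine ne_top_of_le_ne_top ?_ (ENNReal.tsum_le_tsum hle)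
  rw [tsum_prod_fin_eq_pow fun k => ENNReal.ofReal (a ^ k.natAbs)]
  refine ENNReal.pow_ne_top ?_
  have hsum : Summable fun k : ℤ => a ^ k.natAbs := by
    have hg := summable_geometric_of_lt_one (Real.exp_pos _).le ha1
    exact Summable.of_nat_of_neg (by simp only [Int.natAbs_natCast]; exact hg)
      (by simp only [Int.natAbs_neg, Int.natAbs_natCast]; exact hg)
  exact hsum.tsum_ofReal_ne_top

/-- Sums of probabilities and of joint probabilities of events that are localized at a finite set
of sites and nearly independent at large distances. -/
theorem sums_le_of_weight {Ω : Type*} [MeasurableSpace Ω] {P : Measure Ω}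
    {E : (Fin d → ℤ) → Set Ω} {Z : Finset (Fin d → ℤ)} {C : ℝ≥0∞} {c : ℝ}
    (h1 : ∀ z, P (E z) ≤ C * ∑ y ∈ Z, weight c z y)
    (h2 : ∀ z z', P (E z ∩ E z') ≤ P (E z) * P (E z') +
      C * ∑ y ∈ Z, weight c z y * weight c z' z) :
    ∑' z, P (E z) ≤ C * (Z.card * ∑' z, weight (d := d) c z 0) ∧
    ∑' z, ∑' z', P (E z ∩ E z') ≤ (∑' z, P (E z)) ^ 2 +
      C * (Z.card * (∑' z, weight (d := d) c z 0) ^ 2) := by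
  set S := ∑' z, weight (d := d) c z 0
  have hS : ∑' z, ∑ y ∈ Z, weight c z y = Z.card * S := by
    rw [Summable.tsum_finsetSum fun _ _ => ENNReal.summable]
    simp_rw [tsum_weight_eq c, Finset.sum_const, nsmul_eq_mul]
    rfl
  constructor
  · calc ∑' z, P (E z) ≤ ∑' z, C * ∑ y ∈ Z, weight c z y := ENNReal.tsum_le_tsum h1
      _ = _ := by rw [ENNReal.tsum_mul_left, hS]
  · calc ∑' z, ∑' z', P (E z ∩ E z') ≤ ∑' z, ∑' z', (P (E z) * P (E z') +
          C * ∑ y ∈ Z, weight c z y * weight c z' z) :=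
          ENNReal.tsum_le_tsum fun z => ENNReal.tsum_le_tsum fun z' => h2 z z'
      _ = ∑' z, (P (E z) * ∑' z', P (E z') + C * ((∑ y ∈ Z, weight c z y) * S)) := by
          refine tsum_congr fun z => ?_
          rw [ENNReal.tsum_add, ENNReal.tsum_mul_left, ENNReal.tsum_mul_left]
          simp_rw [← Finset.sum_mul]
          rw [ENNReal.tsum_mul_left, tsum_weight_eq]
      _ = _ := by
          rw [ENNReal.tsum_add, ENNReal.tsum_mul_right, ENNReal.tsum_mul_left,
            ENNReal.tsum_mul_right, hS, sq, sq, mul_assoc]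

end Decay

/-! ### Boundary effects -/

section Boundary

variable {d : ℕ}

/-- The region `A` or the whole space. -/
def region (b : Bool) (A : Set (EuclideanSpace ℝ (Fin d))) : Set (EuclideanSpace ℝ (Fin d)) :=
  bif b then A else Set.univ

theorem measurableSet_region (b : Bool) {A : Set (EuclideanSpace ℝ (Fin d))}
    (hA : MeasurableSet A) : MeasurableSet (region b A) := by
  cases b
  · exact .univ
  · exact hA

/-- The points of `A` that belong to one of the packing on `A` and the packing on the whole space,
but not to the other. -/
def discrepancy (X : Set (SpaceTime d)) (b : Bool) (A : Set (EuclideanSpace ℝ (Fin d))) :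
    Set (EuclideanSpace ℝ (Fin d)) :=
  (A ∩ packing (restrictInput X (region b A))) \ packing (restrictInput X (region (!b) A))

theorem excess_eq_discrepancy (X : Set (SpaceTime d)) (A : Set (EuclideanSpace ℝ (Fin d))) :
    excess X A = discrepancy X true A := by
  have h : ∀ x ∈ packing (restrictInput X A), x ∈ A := by
    rintro _ ⟨w, hw, rfl⟩
    exact (Fate.mem hw).2
  ext x
  simp only [excess, discrepancy, region, cond_true, Bool.not_true, cond_false,
    restrictInput_univ, Set.mem_sdiff, Set.mem_inter_iff]
  constructor
  · rintro ⟨h1, h2⟩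
    exact ⟨⟨h x h1, h1⟩, fun h3 => h2 ⟨h3, h x h1⟩⟩
  · rintro ⟨⟨_, h1⟩, h2⟩
    exact ⟨h1, fun h3 => h2 h3.1⟩

theorem deficit_eq_discrepancy (X : Set (SpaceTime d)) (A : Set (EuclideanSpace ℝ (Fin d))) :
    deficit X A = discrepancy X false A := by
  simp [deficit, discrepancy, region, restrictInput_univ, Set.inter_comm A]

/-- Only the input inside `A` matters, so `A` can be exchanged for a measurable set that almost
surely selects the same balls. -/
theorem discrepancy_congr {X : Set (SpaceTime d)} {A A' : Set (EuclideanSpace ℝ (Fin d))}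
    (h : restrictInput X A = restrictInput X A') (b : Bool) :
    discrepancy X b A = discrepancy X b A' := by
  have h1 : ∀ b, restrictInput X (region b A) = restrictInput X (region b A') := by
    intro b
    cases b
    · rfl
    · exact h
  have h2 : ∀ R, A ∩ packing (restrictInput X R) = A' ∩ packing (restrictInput X R) := by
    intro R
    ext x
    refine and_congr_left ?_
    rintro ⟨w, hw, rfl⟩
    have hwX : w ∈ X := (Fate.mem hw).1
    have h3 : w ∈ restrictInput X A ↔ w ∈ restrictInput X A' := by rw [h]
    exact ⟨fun hA => (h3.1 ⟨hwX, hA⟩).2, fun hA => (h3.2 ⟨hwX, hA⟩).2⟩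
  rw [discrepancy, discrepancy, h1, h1, h2]

variable {Ω : Type*} [mΩ : MeasurableSpace Ω] {P : Measure Ω} [IsProbabilityMeasure P]
  {X : Ω → Set (SpaceTime d)} {m : Measure (SpaceTime d)}

/-- The event that there is a discrepancy in the grid cube `z`. -/
def cubeEvent (X : Ω → Set (SpaceTime d)) (b : Bool) (A : Set (EuclideanSpace ℝ (Fin d)))
    (z : Fin d → ℤ) : Set Ω :=
  {ω | ∃ x ∈ discrepancy (X ω) b A, cell x = z}

omit mΩ in
theorem cubeEvent_eq_differEvent (X : Ω → Set (SpaceTime d)) (b : Bool)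
    (A : Set (EuclideanSpace ℝ (Fin d))) (z : Fin d → ℤ) :
    cubeEvent X b A z = differEvent X (cell ⁻¹' {z} ∩ A) (region b A) (region (!b) A) := by
  ext ω
  refine exists_congr fun x => ?_
  simp only [discrepancy, Set.mem_sdiff, Set.mem_inter_iff, Set.mem_preimage,
    Set.mem_singleton_iff]
  tauto

omit [IsProbabilityMeasure P] in
theorem cubeEvent_ae_eq {A A' : Set (EuclideanSpace ℝ (Fin d))}
    (h : ∀ᵐ ω ∂P, restrictInput (X ω) A = restrictInput (X ω) A') (b : Bool) (z : Fin d → ℤ) :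
    cubeEvent X b A z =ᵐ[P] cubeEvent X b A' z := by
  filter_upwards [h] with ω hω
  refine propext ?_
  change (∃ x ∈ discrepancy (X ω) b A, cell x = z) ↔ ∃ x ∈ discrepancy (X ω) b A', cell x = z
  rw [discrepancy_congr hω]

/-- The maximum is at least the average; half of the decay rate is given up so that both distances
decay at once. -/
theorem exp_max_le {c s t : ℝ} (hc : 0 ≤ c) :
    Real.exp (-(c * max s t)) ≤ Real.exp (-(c / 2 * s)) * Real.exp (-(c / 2 * t)) := by
  rw [← Real.exp_add]
  refine Real.exp_le_exp.2 ?_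
  have h1 := mul_le_mul_of_nonneg_left (le_max_left s t) hc
  have h2 := mul_le_mul_of_nonneg_left (le_max_right s t) hc
  linarith

/-- Discrepancies are concentrated near the boundary and nearly independent at large distances. -/
theorem IsRegularInput.exists_cubeEvent_bounds (hX : IsRegularInput X m P) (hd : 1 ≤ d) :
    ∃ C c : ℝ, 0 ≤ C ∧ 0 < c ∧ ∀ (b : Bool) (A : Set (EuclideanSpace ℝ (Fin d)))
      (Z : Finset (Fin d → ℤ)), volume (frontier A) = 0 → (∀ x ∈ frontier A, cell x ∈ Z) →
        (∀ z, NullMeasurableSet (cubeEvent X b A z) P) ∧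
        (∀ z, P (cubeEvent X b A z) ≤ ENNReal.ofReal C * ∑ y ∈ Z, weight c z y) ∧
        ∀ z z', P (cubeEvent X b A z ∩ cubeEvent X b A z') ≤
          P (cubeEvent X b A z) * P (cubeEvent X b A z') +
            ENNReal.ofReal C * ∑ y ∈ Z, weight c z y * weight c z' z := by
  obtain ⟨K, c, hK, hc, hnear, hfar⟩ := hX.exists_measure_inter_le
  have hd' : (0 : ℝ) < d := by exact_mod_cast hd
  set C := K * Real.exp c + 1 with hCdef
  have hC : 0 ≤ C := by positivity
  -- Decorrelation over `n` steps needs distance `4 * d * n`, localization at the boundary only `2 *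
  -- d * n`; the slower rate serves both.
  set c₂ := c / (4 * d) with hc₂
  have hc₂pos : 0 < c₂ := by positivity
  refine ⟨C, c₂ / 2, hC, by positivity, fun b A Z hA hZ => ?_⟩
  obtain ⟨A', hA'm, hA'⟩ := hX.exists_measurable A hA
  have hnull : ∀ z, NullMeasurableSet (cubeEvent X b A z) P := by
    intro z
    refine NullMeasurableSet.congr ?_ (cubeEvent_ae_eq hA' b z).symm
    rw [cubeEvent_eq_differEvent]
    exact hX.nullMeasurableSet_differEvent ((measurableSet_cell_preimage z).inter hA'm)
      (measurableSet_region _ hA'm) (measurableSet_region _ hA'm)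
  have hstep : ∀ (z : Fin d → ℤ) (n : ℕ), (∀ y ∈ Z, 2 * d * n < dist y z) →
      P (cubeEvent X b A z) ≤ ENNReal.ofReal (K * Real.exp (-(c * n))) := by
    intro z n hn
    by_cases hx : ∃ x ∈ A, cell x = z
    · obtain ⟨x, hxA, hxz⟩ := hx
      have hsub := nearby_subset_of_forall_frontier hZ hn hxA hxz
      have := hnear n z A (cell ⁻¹' {z} ∩ A) Set.univ hsub Set.inter_subset_left
      rw [Set.univ_inter] at this
      rw [cubeEvent_eq_differEvent]
      cases b
      · exact this.1
      · exact this.2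
    · have : cubeEvent X b A z = ∅ := by
        rw [Set.eq_empty_iff_forall_notMem]
        rintro ω ⟨x, hxD, hxz⟩
        exact hx ⟨x, hxD.1.1, hxz⟩
      rw [this, measure_empty]
      exact zero_le
  have hone : ∀ z, P (cubeEvent X b A z) = 0 ∨
      ∃ y ∈ Z, P (cubeEvent X b A z) ≤ ENNReal.ofReal (C * Real.exp (-(c₂ * dist z y))) := by
    intro z
    -- Without boundary cubes every `n` is admissible, so the probability vanishes; otherwise the
    -- nearest boundary cube gives the decay.
    rcases Z.eq_empty_or_nonempty with rfl | hne
    · left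
      have hlim : Tendsto (fun n : ℕ => ENNReal.ofReal (K * Real.exp (-(c * n)))) atTop (nhds 0) := by
        rw [← ENNReal.ofReal_zero, ← mul_zero K]
        refine ENNReal.tendsto_ofReal (Tendsto.const_mul K ?_)
        refine Real.tendsto_exp_neg_atTop_nhds_zero.comp ?_
        exact tendsto_natCast_atTop_atTop.const_mul_atTop hc
      exact nonpos_iff_eq_zero.1 (ge_of_tendsto' hlim fun n => hstep z n (by simp))
    · right
      obtain ⟨y, hy, hmin⟩ := Z.exists_min_image (fun y => dist y z) hne
      refine ⟨y, hy, ?_⟩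
      have := le_exp_of_forall_nat (q := P (cubeEvent X b A z)) prob_le_one hK hc
        (K := 2 * d) (by positivity) (dist_nonneg (x := y) (y := z)) fun n hn =>
          hstep z n fun y' hy' => hn.trans_le (hmin y' hy')
      refine this.trans (ENNReal.ofReal_le_ofReal ?_)
      rw [dist_comm y z]
      gcongr
      rw [hc₂]
      gcongr
      norm_num
  refine ⟨hnull, fun z => ?_, fun z z' => ?_⟩
  · rcases hone z with h0 | ⟨y, hy, hyz⟩
    · rw [h0]; exact zero_le
    · calc P (cubeEvent X b A z) ≤ ENNReal.ofReal C * weight (c₂ / 2) z y := by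
            refine hyz.trans ?_
            rw [weight, ← ENNReal.ofReal_mul hC]
            refine ENNReal.ofReal_le_ofReal ?_
            gcongr
            linarith
        _ ≤ _ := by
            gcongr
            exact Finset.single_le_sum (f := fun y => weight (c₂ / 2) z y)
              (fun _ _ => zero_le) hy
  · rcases hone z with h0 | ⟨y, hy, hyz⟩
    · rw [measure_mono_null Set.inter_subset_left h0]
      exact zero_le
    -- The truncated covariance `q` inherits the decay from the boundary through `P (E z)` and the
    -- decay in the distance of the two cubes from near independence; both are then combined.
    · rw [← tsub_le_iff_left]
      set q := P (cubeEvent X b A z ∩ cubeEvent X b A z') -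
        P (cubeEvent X b A z) * P (cubeEvent X b A z')
      have hq1 : q ≤ ENNReal.ofReal (C * Real.exp (-(c₂ * dist z y))) :=
        tsub_le_self.trans ((measure_mono Set.inter_subset_left).trans hyz)
      have hq2 : q ≤ ENNReal.ofReal (C * Real.exp (-(c₂ * dist z' z))) := by
        rw [dist_comm z' z]
        refine le_exp_of_forall_nat (tsub_le_self.trans prob_le_one) hK hc (K := 4 * d)
          (by positivity) dist_nonneg fun n hn => ?_
        rw [tsub_le_iff_left]
        have hinter : P (cubeEvent X b A z ∩ cubeEvent X b A z') =
            P (cubeEvent X b A' z ∩ cubeEvent X b A' z') :=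
          measure_congr ((cubeEvent_ae_eq hA' b z).inter (cubeEvent_ae_eq hA' b z'))
        rw [hinter, measure_congr (cubeEvent_ae_eq hA' b z),
          measure_congr (cubeEvent_ae_eq hA' b z'), cubeEvent_eq_differEvent,
          cubeEvent_eq_differEvent]
        exact hfar n z z' _ _ _ _ hn Set.inter_subset_left Set.inter_subset_left
          ((measurableSet_cell_preimage z).inter hA'm)
          ((measurableSet_cell_preimage z').inter hA'm)
          (measurableSet_region _ hA'm) (measurableSet_region _ hA'm)
      calc q ≤ ENNReal.ofReal (C * Real.exp (-(c₂ * max (dist z y) (dist z' z)))) := by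
            rcases max_cases (dist z y) (dist z' z) with ⟨h, _⟩ | ⟨h, _⟩
            · rwa [h]
            · rwa [h]
        _ ≤ ENNReal.ofReal C * (weight (c₂ / 2) z y * weight (c₂ / 2) z' z) := by
            rw [weight, weight, ← ENNReal.ofReal_mul (Real.exp_pos _).le, ← ENNReal.ofReal_mul hC]
            refine ENNReal.ofReal_le_ofReal ?_
            gcongr
            exact exp_max_le hc₂pos.le
        _ ≤ _ := by
            gcongr
            exact Finset.single_le_sum (f := fun y => weight (c₂ / 2) z y * weight (c₂ / 2) z' z)
              (fun _ _ => zero_le) hy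

theorem encard_eq_tsum_indicator {E ι : Type*} {D : Set E} {f : E → ι} (hf : Set.InjOn f D) :
    (D.encard : ℝ≥0∞) = ∑' z, (f '' D).indicator (1 : ι → ℝ≥0∞) z := by
  rw [← hf.encard_image, ← ENNReal.tsum_set_one, ← tsum_subtype]
  rfl

/-- The moments of the number of discrepancies are bounded by the size of the boundary. -/
theorem IsRegularInput.exists_moment_bound (hX : IsRegularInput X m P) (hd : 1 ≤ d)
    {A : Set (EuclideanSpace ℝ (Fin d))} (hA : HasPiecewiseSmoothBoundary A) :
    ∃ K : ℝ, ∀ (b : Bool) (r : ℝ), 0 < r →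
      (∀ᵐ ω ∂P, (discrepancy (X ω) b (r • A)).Finite) ∧
      MemLp (fun ω => ((discrepancy (X ω) b (r • A)).ncard : ℝ)) 2 P ∧
      ∫ ω, ((discrepancy (X ω) b (r • A)).ncard : ℝ) ∂P ≤ K * (r + 1) ^ (d - 1) ∧
      variance (fun ω => ((discrepancy (X ω) b (r • A)).ncard : ℝ)) P ≤ K * (r + 1) ^ (d - 1) := by
  obtain ⟨C, c, hC, hc, hbounds⟩ := hX.exists_cubeEvent_bounds hd
  obtain ⟨C', hcells⟩ := hA.exists_cells
  obtain ⟨s, hs0, hs'⟩ : ∃ s : ℝ, 0 ≤ s ∧ ∑' z, weight (d := d) c z 0 = ENNReal.ofReal s :=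
    ⟨_, ENNReal.toReal_nonneg, (ENNReal.ofReal_toReal (tsum_weight_ne_top hc)).symm⟩
  -- The term `s` covers the mean and `s ^ 2` the variance, so one constant serves both.
  refine ⟨C * (s + s ^ 2) * C', fun b r hr => ?_⟩
  obtain ⟨Z, hZcard, hZ⟩ := hcells r hr
  have hvol : volume (frontier (r • A)) = 0 := by
    rw [show frontier (r • A) = r • frontier A from
      ((Homeomorph.smulOfNeZero r hr.ne').image_frontier A).symm, Measure.addHaar_smul,
      hA.volume_frontier hd, mul_zero]
  obtain ⟨hnull, h1, h2⟩ := hbounds b (r • A) Z hvol hZ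
  obtain ⟨hsum1, hsum2⟩ := sums_le_of_weight h1 h2
  have hcount : ∀ᵐ ω ∂P, ((discrepancy (X ω) b (r • A)).encard : ℝ≥0∞) =
      ∑' z, (cubeEvent X b (r • A) z).indicator 1 ω := by
    filter_upwards [hX.unique] with ω hω
    rw [encard_eq_tsum_indicator (f := cell)]
    · rfl
    · rintro x ⟨⟨_, w, hw, rfl⟩, _⟩ y ⟨⟨_, v, hv, rfl⟩, _⟩ hxy
      rw [hω _ w v hw hv hxy]
  have hmeas : AEMeasurable (fun ω => ∑' z, (cubeEvent X b (r • A) z).indicator (1 : Ω → ℝ≥0∞) ω) P :=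
    AEMeasurable.tsum fun z => AEMeasurable.indicator₀ (f := 1) aemeasurable_const (hnull z)
  have hle : C * (Z.card * s) ≤ C * (s + s ^ 2) * C' * (r + 1) ^ (d - 1) ∧
      C * (Z.card * s ^ 2) ≤ C * (s + s ^ 2) * C' * (r + 1) ^ (d - 1) := by
    have h3 : C * (s + s ^ 2) * Z.card ≤ C * (s + s ^ 2) * (C' * (r + 1) ^ (d - 1)) := by gcongr
    have h4 : 0 ≤ C * (Z.card * s) := by positivity
    have h5 : 0 ≤ C * (Z.card * s ^ 2) := by positivity
    constructor <;> nlinarith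
  have hmom := moments_of_lintegral_le hmeas hcount (a := C * (Z.card * s))
    (v := C * (Z.card * s ^ 2)) (by positivity) (by positivity) ?_ ?_
  · exact ⟨hmom.1, hmom.2.1, hmom.2.2.1.trans hle.1, hmom.2.2.2.trans hle.2⟩
  · rw [lintegral_tsum_indicator hnull]
    refine hsum1.trans_eq ?_
    rw [hs', ENNReal.ofReal_mul hC, ENNReal.ofReal_mul (by positivity), ENNReal.ofReal_natCast]
  · rw [lintegral_tsum_indicator_sq hnull, lintegral_tsum_indicator hnull]
    refine hsum2.trans_eq ?_
    rw [hs', ENNReal.ofReal_mul hC, ENNReal.ofReal_mul (by positivity), ENNReal.ofReal_natCast,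
      ENNReal.ofReal_pow hs0]

theorem isBigO_pow_of_le {f : ℝ → ℝ} {K : ℝ} {k : ℕ} (h0 : ∀ r, 0 ≤ f r)
    (h : ∀ r, 0 < r → f r ≤ K * (r + 1) ^ k) : f =O[atTop] fun r => r ^ k := by
  refine IsBigO.of_bound (|K| * 2 ^ k) ?_
  filter_upwards [eventually_ge_atTop 1] with r hr
  rw [Real.norm_of_nonneg (h0 r), Real.norm_of_nonneg (by positivity)]
  calc f r ≤ K * (r + 1) ^ k := h r (by linarith)
    _ ≤ |K| * (2 * r) ^ k := by
        gcongr
        · exact le_abs_self K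
        · linarith
    _ = _ := by rw [mul_pow]; ring

theorem IsRegularInput.meanAndVarianceOfOrder (hX : IsRegularInput X m P) (hd : 1 ≤ d)
    {A : Set (EuclideanSpace ℝ (Fin d))} (hA : HasPiecewiseSmoothBoundary A) (b : Bool) :
    MeanAndVarianceOfOrder P (fun r ω => discrepancy (X ω) b (r • A)) (d - 1) := by
  obtain ⟨K, hK⟩ := hX.exists_moment_bound hd hA
  refine ⟨fun r hr => ⟨(hK b r hr).1, (hK b r hr).2.1⟩, ?_, ?_⟩
  · exact isBigO_pow_of_le (fun r => integral_nonneg fun ω => by positivity)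
      fun r hr => (hK b r hr).2.2.1
  · exact isBigO_pow_of_le (fun r => variance_nonneg _ _) fun r hr => (hK b r hr).2.2.2

end Boundary

end RandomPacking

theorem proposition4p1 {d : ℕ} (hd : 1 ≤ d) (A : Set (EuclideanSpace ℝ (Fin d)))
    (hA : RandomPacking.HasPiecewiseSmoothBoundary A)
    {Ω : Type*} [MeasurableSpace Ω] (P : Measure Ω) [IsProbabilityMeasure P]
    (X : Ω → Set (RandomPacking.SpaceTime d))
    (hX : (∃ τ : ℝ, 0 < τ ∧
        RandomPacking.IsPoissonPointProcess X (RandomPacking.continuumIntensity d τ) P) ∨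
      RandomPacking.IsPoissonPointProcess X (RandomPacking.latticeIntensity d) P) :
    RandomPacking.MeanAndVarianceOfOrder P
        (fun r ω => RandomPacking.excess (X ω) (r • A)) (d - 1) ∧
      RandomPacking.MeanAndVarianceOfOrder P
        (fun r ω => RandomPacking.deficit (X ω) (r • A)) (d - 1) := by
  simp only [RandomPacking.excess_eq_discrepancy, RandomPacking.deficit_eq_discrepancy]
  rcases hX with ⟨τ, hτ, hX⟩ | hX
  · have h := RandomPacking.isRegularInput_continuum hd hτ hX
    exact ⟨h.meanAndVarianceOfOrder hd hA true, h.meanAndVarianceOfOrder hd hA false⟩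
  · have h := RandomPacking.isRegularInput_lattice hd hX
    exact ⟨h.meanAndVarianceOfOrder hd hA true, h.meanAndVarianceOfOrder hd hA false⟩
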